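/- Let $M$ be a smooth, paracompact, finite-dimensional manifold (Hausdorff, without boundary). A \emph{distribution} $H$ on $M$ assigns to each $x\in M$ a linear subspace $H_x\subseteq T_xM$. A \emph{local vector field} is a smooth vector field on an open subset of $M$; it is \emph{horizontal} if its value at every point $x$ of its domain lies in $H_x$. A set of local vector fields \emph{spans} the distribution whose fibre at $x$ is the linear hull of the values at $x$ of those members of the set that are defined at $x$. The distribution $H$ is \emph{smooth} if it is spanned by its local horizontal vector fields; it is \emph{regular} if $x\mapsto\dim H_x$ is locally constant; it is \emph{bracket generating} if the smallest set of local vector fields that contains all local horizontal vector fields and is closed under Lie brackets (a bracket being defined on the intersection of the domains) spans $TM$. A \emph{smooth subriemannian metric} on $H$ assigns to each $x\in M$ an inner product $\langle\cdot,\cdot\rangle_x$ on $H_x$ such that $x\mapsto\langle X(x),Y(x)\rangle_x$ is smooth for all local horizontal vector fields $X,Y$; put $\|v\|_x=\sqrt{\langle v,v\rangle_x}$. A curve $\gamma:[a,b]\to M$ is \emph{controlled} by local vector fields $X_1,\dots,X_k$ defined near $\gamma([a,b])$ if it is absolutely continuous (that is, in every chart) and there are $u_1,\dots,u_k\in L^1([a,b];\mathbb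 R)$ with $\dot\gamma(t)=\sum_{i=1}^k u_i(t)X_i(\gamma(t))$ for almost every $t$. A curve is \emph{horizontal} if it is a finite concatenation of curves each of which is controlled by finitely many local horizontal vector fields. The length of a horizontal curve $\gamma:[a,b]\to M$ is $l(\gamma)=\int_a^b\|\dot\gamma(t)\|_{\gamma(t)}\,dt$. The subriemannian distance $d(x,y)\in[0,\infty]$ is the infimum of $l(\gamma)$ over all horizontal curves $\gamma$ from $x$ to $y$ (and $\infty$ if there is none), and $B(\epsilon,x)=\{y\in M: d(x,y)<\epsilon\}$. \textbf{Theorem.} Let $H$ be a smooth, regular, bracket generating distribution on $M$, endowed with a smooth subriemannian metric. Then for every $x_0\in M$ and every $\epsilon>0$, the subriemannian ball $B(\epsilon,x_0)$ is a neighbourhood of $x_0$ in the manifold topology of $M$. -/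

import Mathlib

open Set MeasureTheory
open scoped Manifold ContDiff Topology ENNReal

namespace Subriemannian

/-- A smooth vector field on an open subset `dom` of the manifold `M` (`dom` may be empty). The
values of `toFun` outside `dom` are junk and are never used below. -/
structure LocalVectorField (E : Type*) [NormedAddCommGroup E] [NormedSpace ℝ E]
    (M : Type*) [TopologicalSpace M] [ChartedSpace E M] [IsManifold 𝓘(ℝ, E) ∞ M] where
  dom : Set M
  isOpen_dom : IsOpen dom
  toFun : ∀ x : M, TangentSpace 𝓘(ℝ, E) x
  smooth : ContMDiffOn 𝓘(ℝ, E) 𝓘(ℝ, E).tangent ∞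
    (fun x => (⟨x, toFun x⟩ : TangentBundle 𝓘(ℝ, E) M)) dom

/-- A distribution on `M`: a linear subspace of `T_x M` for each point `x`. -/
abbrev TangentDistribution (E : Type*) [NormedAddCommGroup E] [NormedSpace ℝ E]
    (M : Type*) [TopologicalSpace M] [ChartedSpace E M] :=
  ∀ x : M, Submodule ℝ (TangentSpace 𝓘(ℝ, E) x)

section

variable {E : Type*} [NormedAddCommGroup E] [NormedSpace ℝ E]
  {M : Type*} [TopologicalSpace M] [ChartedSpace E M] [IsManifold 𝓘(ℝ, E) ∞ M]

/-- The Lie bracket of two local vector fields, defined on the intersection of their domains. -/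
noncomputable def LocalVectorField.bracket [FiniteDimensional ℝ E]
    (X Y : LocalVectorField E M) : LocalVectorField E M where
  dom := X.dom ∩ Y.dom
  isOpen_dom := X.isOpen_dom.inter Y.isOpen_dom
  toFun := VectorField.mlieBracket 𝓘(ℝ, E) X.toFun Y.toFun
  smooth := by
    have hc : CompleteSpace E := FiniteDimensional.complete ℝ E
    have hm : IsManifold 𝓘(ℝ, E) (((⊤ : ℕ∞) : ℕ∞ω) + 1) M := by
      simpa using (inferInstance : IsManifold 𝓘(ℝ, E) ∞ M)
    have hm' : IsManifold 𝓘(ℝ, E) (minSmoothness ℝ 2) M := by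
      rw [minSmoothness_of_isRCLikeNormedField]
      exact inferInstance
    intro x hx
    have hX := (X.smooth x hx.1).contMDiffAt (X.isOpen_dom.mem_nhds hx.1)
    have hY := (Y.smooth x hx.2).contMDiffAt (Y.isOpen_dom.mem_nhds hx.2)
    exact (ContMDiffAt.mlieBracket_vectorField (m := (⊤ : ℕ∞)) (n := (⊤ : ℕ∞)) hX hY
      (by simp)).contMDiffWithinAt

/-- The distribution spanned by a set of local vector fields. -/
noncomputable def spannedBy (𝒱 : Set (LocalVectorField E M)) : TangentDistribution E M :=
  fun x => Submodule.span ℝ {v | ∃ X ∈ 𝒱, x ∈ X.dom ∧ X.toFun x = v}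

/-- A set of local vector fields is involutive if it is closed under Lie brackets. -/
def IsInvolutive [FiniteDimensional ℝ E] (𝒱 : Set (LocalVectorField E M)) : Prop :=
  ∀ X ∈ 𝒱, ∀ Y ∈ 𝒱, X.bracket Y ∈ 𝒱

/-- The Lie hull of `𝒱`: the smallest involutive set of local vector fields containing `𝒱`. -/
def lieHull [FiniteDimensional ℝ E] (𝒱 : Set (LocalVectorField E M)) :
    Set (LocalVectorField E M) :=
  ⋂₀ {𝒲 | 𝒱 ⊆ 𝒲 ∧ IsInvolutive 𝒲}

namespace TangentDistribution

/-- The set of local vector fields that are horizontal at every point of their domain. -/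
def horizontalFields (H : TangentDistribution E M) : Set (LocalVectorField E M) :=
  {X | ∀ x ∈ X.dom, X.toFun x ∈ H x}

/-- `H` is smooth if it is spanned by its local horizontal vector fields. -/
def IsSmooth (H : TangentDistribution E M) : Prop :=
  spannedBy H.horizontalFields = H

/-- `H` is regular if the dimension of `H x` is locally constant. -/
def IsRegular (H : TangentDistribution E M) : Prop :=
  IsLocallyConstant (fun x => Module.finrank ℝ (H x))

/-- `H` is bracket generating if the horizontal fields and their iterated Lie brackets span every
tangent space. -/
def IsBracketGenerating [FiniteDimensional ℝ E] (H : TangentDistribution E M) : Prop :=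
  ∀ x, spannedBy (lieHull H.horizontalFields) x = ⊤

end TangentDistribution

open Classical in
/-- Apply a family of bilinear forms on the spaces `H x` to two tangent vectors at `x`; the value
is `0`, by convention, if one of the vectors is not in `H x`. -/
noncomputable def evalForm {H : TangentDistribution E M}
    (g : ∀ x : M, LinearMap.BilinForm ℝ (H x)) (x : M) (v w : TangentSpace 𝓘(ℝ, E) x) : ℝ :=
  if h : v ∈ H x ∧ w ∈ H x then g x ⟨v, h.1⟩ ⟨w, h.2⟩ else 0

/-- A smooth subriemannian metric on `H`: an inner product on each `H x` such that
`x ↦ ⟨X(x), Y(x)⟩_x` is smooth for all local horizontal vector fields `X` and `Y`. -/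
structure SubriemannianMetric (H : TangentDistribution E M) where
  form : ∀ x : M, LinearMap.BilinForm ℝ (H x)
  symm : ∀ (x : M) (v w : H x), form x v w = form x w v
  pos : ∀ (x : M) (v : H x), v ≠ 0 → 0 < form x v v
  smooth : ∀ X ∈ H.horizontalFields, ∀ Y ∈ H.horizontalFields,
    ContMDiffOn 𝓘(ℝ, E) 𝓘(ℝ, ℝ) ∞ (fun x => evalForm form x (X.toFun x) (Y.toFun x))
      (X.dom ∩ Y.dom)

/-- The norm `√⟨v, v⟩_x` of a horizontal tangent vector `v` at `x`. -/
noncomputable def SubriemannianMetric.norm {H : TangentDistribution E M}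
    (g : SubriemannianMetric H) (x : M) (v : TangentSpace 𝓘(ℝ, E) x) : ℝ :=
  Real.sqrt (evalForm g.form x v v)

variable (E) in
/-- The curve `γ : [a, b] → M` is absolutely continuous: it is continuous, and it is absolutely
continuous in every chart `e` of the smooth structure, on every subinterval that `γ` maps into the
domain of `e`. -/
def IsAbsolutelyContinuousCurve (γ : ℝ → M) (a b : ℝ) : Prop :=
  ContinuousOn γ (Icc a b) ∧
  ∀ e ∈ IsManifold.maximalAtlas 𝓘(ℝ, E) ∞ M, ∀ t₀ t₁ : ℝ, a ≤ t₀ → t₀ ≤ t₁ → t₁ ≤ b →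
    (∀ t ∈ Icc t₀ t₁, γ t ∈ e.source) →
      AbsolutelyContinuousOnInterval (fun t => e (γ t)) t₀ t₁

/-- The curve `γ : [a, b] → M` is controlled by the local vector fields `X 0, …, X (k - 1)`, which
are defined near `γ([a, b])`: it is absolutely continuous and
`γ'(t) = ∑ i, u i t • X i (γ t)` for almost all `t`, with controls `u i` in `L¹([a, b])`. -/
def IsControlledBy (γ : ℝ → M) (a b : ℝ) {k : ℕ} (X : Fin k → LocalVectorField E M) : Prop :=
  (∀ i, ∀ t ∈ Icc a b, γ t ∈ (X i).dom) ∧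
  IsAbsolutelyContinuousCurve E γ a b ∧
  ∃ u : Fin k → ℝ → ℝ, (∀ i, IntegrableOn (u i) (Icc a b)) ∧
    ∀ᵐ t ∂(volume.restrict (Icc a b)),
      HasMFDerivAt 𝓘(ℝ, ℝ) 𝓘(ℝ, E) γ t
        ((1 : ℝ →L[ℝ] ℝ).smulRight (∑ i, u i t • (X i).toFun (γ t)))

/-- `γ : [a, b] → M` is a horizontal curve: a finite concatenation of curves that are controlled by
horizontal local vector fields. -/
inductive IsHorizontalCurve (H : TangentDistribution E M) (γ : ℝ → M) : ℝ → ℝ → Prop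
  | controlled {a b : ℝ} (hab : a ≤ b) {k : ℕ} (X : Fin k → LocalVectorField E M)
      (hX : ∀ i, X i ∈ H.horizontalFields) (h : IsControlledBy γ a b X) :
      IsHorizontalCurve H γ a b
  | concat {a b c : ℝ} (h₁ : IsHorizontalCurve H γ a b) (h₂ : IsHorizontalCurve H γ b c) :
      IsHorizontalCurve H γ a c

namespace SubriemannianMetric

variable {H : TangentDistribution E M}

/-- The length `∫_a^b ‖γ'(t)‖ dt` of a horizontal curve `γ : [a, b] → M`. -/
noncomputable def length (g : SubriemannianMetric H) (γ : ℝ → M) (a b : ℝ) : ℝ≥0∞ :=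
  ∫⁻ t in Icc a b, ENNReal.ofReal (g.norm (γ t) (mfderiv 𝓘(ℝ, ℝ) 𝓘(ℝ, E) γ t (1 : ℝ)))

/-- The subriemannian distance: the infimum of the lengths of the horizontal curves from `x` to `y`,
which is `∞` if there is no such curve. -/
noncomputable def dist (g : SubriemannianMetric H) (x y : M) : ℝ≥0∞ :=
  sInf {l | ∃ (γ : ℝ → M) (a b : ℝ),
    IsHorizontalCurve H γ a b ∧ γ a = x ∧ γ b = y ∧ l = g.length γ a b}

/-- The subriemannian ball `B(ε, x)`. -/
def ball (g : SubriemannianMetric H) (ε : ℝ) (x : M) : Set M :=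
  {y | g.dist x y < ENNReal.ofReal ε}

end SubriemannianMetric

end

end Subriemannian

/-! Pullback of functions along the time-`s` flow of `V` has Taylor series `exp(s L_V)`, and for
words of flows these series multiply. The group commutator of words with series `1 + a sʲ + …` and
`1 + b sᵏ + …` has series `1 + [a, b] sʲ⁺ᵏ + …`. So each iterated bracket `Z` of horizontal fields,
read in a chart and cut off to compact support, is the leading coefficient of some word
(`IsIteratedBracket.exists_word`). Following that word for time `s` per letter moves `y` by `sʳ Z y
+ O(sʳ⁺¹)` (`exists_norm_displacement_sub_le`); the inverse word realises `-Z`.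

By bracket generation, finitely many iterated brackets form a basis at the base point. Moves along
them, one after the other, realise any small displacement up to a small relative error, uniformly in
the starting point. Correcting the remaining error at successively halved scales gives moves whose
durations are dominated by a geometric series and whose endpoints converge to the target. The target
is thus reached exactly, in arbitrarily short time (`exists_reaches_of_contraction`), without any
differentiability of an endpoint map.

The resulting infinite concatenation is Lipschitz, and outside a countable set its velocity is the
value of one of finitely many fields. Measurable 0-1 controls make it one controlled curve, although
it may have infinitely many switches. The fields have bounded norm near `x₀`, so short duration
means short length. -/

namespace Subriemannian

/-! ### Formal exponentials and leading terms of group commutators -/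

section PowerSeries

open PowerSeries

variable {A : Type*} [Ring A]

/-- The formal exponential `∑ (n!)⁻¹ aⁿ Xⁿ` of an element of a real algebra. -/
noncomputable def expSeries [Algebra ℝ A] (a : A) : PowerSeries A :=
  PowerSeries.mk fun n => ((n.factorial : ℝ)⁻¹) • a ^ n

/-- Substituting `a X` for the variable is multiplicative because powers of a single element
commute. This carries identities of real power series over to `A`. -/
theorem mk_smul_pow_mul [Algebra ℝ A] (a : A) (f g : PowerSeries ℝ) :
    (PowerSeries.mk fun n => coeff n f • a ^ n) * (PowerSeries.mk fun n => coeff n g • a ^ n)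
      = PowerSeries.mk fun n => coeff n (f * g) • a ^ n := by
  ext n
  simp only [coeff_mul, coeff_mk, Finset.sum_smul]
  refine Finset.sum_congr rfl fun p hp => ?_
  rw [← Finset.HasAntidiagonal.mem_antidiagonal.1 hp, pow_add, smul_mul_smul_comm]

theorem expSeries_mul_neg [Algebra ℝ A] (a : A) : expSeries a * expSeries (-a) = 1 := by
  have h1 : expSeries a = PowerSeries.mk fun n => coeff n (PowerSeries.exp ℝ) • a ^ n := by
    ext n; simp [expSeries, PowerSeries.coeff_exp]
  have h2 : expSeries (-a) =
      PowerSeries.mk fun n => coeff n (evalNegHom (PowerSeries.exp ℝ)) • a ^ n := by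
    ext n
    simp only [expSeries, coeff_mk, evalNegHom, coeff_rescale, coeff_exp]
    rw [neg_pow, show ((-1 : A)^n) = algebraMap ℝ A ((-1)^n) by simp, ← Algebra.smul_def, smul_smul]
    congr 1
    simp [mul_comm]
  rw [h1, h2, mk_smul_pow_mul, PowerSeries.exp_mul_exp_neg_eq_one]
  ext n
  rw [coeff_mk, coeff_one, coeff_one]
  split_ifs with h <;> simp [h]

/-- `P = 1 + a Xʳ + O(Xʳ⁺¹)`. -/
def HasLeadingTerm (P : PowerSeries A) (r : ℕ) (a : A) : Prop :=
  ∃ Q : PowerSeries A, P = 1 + X ^ r * Q ∧ constantCoeff Q = a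

theorem constantCoeff_eq_one_of_mul_eq_one {P P' : PowerSeries A} {r : ℕ} (hr : 1 ≤ r) {a : A}
    (hP : HasLeadingTerm P r a) (h : P * P' = 1) : constantCoeff P' = 1 := by
  obtain ⟨Q, rfl, -⟩ := hP
  have := congrArg constantCoeff h
  simpa [zero_pow (by omega : r ≠ 0)] using this

theorem HasLeadingTerm.inv {P P' : PowerSeries A} {r : ℕ} (hr : 1 ≤ r) {a : A}
    (hP : HasLeadingTerm P r a) (h : P * P' = 1) : HasLeadingTerm P' r (-a) := by
  have hc := constantCoeff_eq_one_of_mul_eq_one hr hP h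
  obtain ⟨Q, rfl, rfl⟩ := hP
  refine ⟨-(Q * P'), ?_, by simp [hc]⟩
  rw [mul_neg, ← mul_assoc, ← sub_eq_add_neg, eq_sub_iff_add_eq, ← h]
  noncomm_ring

/-- Since `Q P P' Q' = 1`, the commutator differs from `1` by `(P Q - Q P) P' Q'`. The constant
terms `1` cancel in `P Q - Q P`, which leaves the factor `Xʲ⁺ᵏ`, while `P'` and `Q'` have constant
coefficient `1`. -/
theorem HasLeadingTerm.commutator {P P' Q Q' : PowerSeries A} {j k : ℕ} (hj : 1 ≤ j) (hk : 1 ≤ k)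
    {a b : A} (hP : HasLeadingTerm P j a) (hQ : HasLeadingTerm Q k b)
    (hPP : P * P' = 1) (hQQ : Q * Q' = 1) :
    HasLeadingTerm (P * Q * P' * Q') (j + k) (a * b - b * a) := by
  have hcP := constantCoeff_eq_one_of_mul_eq_one hj hP hPP
  have hcQ := constantCoeff_eq_one_of_mul_eq_one hk hQ hQQ
  obtain ⟨P₁, hP₁, rfl⟩ := hP
  obtain ⟨Q₁, hQ₁, rfl⟩ := hQ
  refine ⟨(P₁ * Q₁ - Q₁ * P₁) * P' * Q', ?_, by simp [hcP, hcQ]⟩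
  have h1 : P * Q - Q * P = X ^ (j + k) * (P₁ * Q₁ - Q₁ * P₁) := by
    have e1 : (X ^ j * P₁) * (X ^ k * Q₁) = X ^ (j + k) * (P₁ * Q₁) := by
      rw [mul_assoc, ← mul_assoc P₁, (commute_X_pow P₁ k).eq, pow_add]; noncomm_ring
    have e2 : (X ^ k * Q₁) * (X ^ j * P₁) = X ^ (j + k) * (Q₁ * P₁) := by
      rw [mul_assoc, ← mul_assoc Q₁, (commute_X_pow Q₁ j).eq, add_comm j k, pow_add]; noncomm_ring
    rw [mul_sub, ← e1, ← e2, hP₁, hQ₁]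
    noncomm_ring
  have h2 : Q * P * P' * Q' = 1 := by rw [mul_assoc Q, hPP, mul_one, hQQ]
  calc P * Q * P' * Q' = Q * P * P' * Q' + (P * Q - Q * P) * P' * Q' := by noncomm_ring
    _ = _ := by rw [h1, h2]; noncomm_ring

theorem HasLeadingTerm.coeff_zero {P : PowerSeries A} {r : ℕ} (hr : 1 ≤ r) {a : A}
    (hP : HasLeadingTerm P r a) : coeff 0 P = 1 := by
  obtain ⟨Q, rfl, -⟩ := hP
  simp [zero_pow (by omega : r ≠ 0)]

theorem HasLeadingTerm.coeff_of_lt {P : PowerSeries A} {r : ℕ} {a : A}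
    (hP : HasLeadingTerm P r a) {j : ℕ} (h0 : j ≠ 0) (hj : j < r) : coeff j P = 0 := by
  obtain ⟨Q, rfl, -⟩ := hP
  rw [map_add, coeff_X_pow_mul', if_neg (by omega), coeff_one, if_neg h0, add_zero]

theorem HasLeadingTerm.coeff_self {P : PowerSeries A} {r : ℕ} (hr : 1 ≤ r) {a : A}
    (hP : HasLeadingTerm P r a) : coeff r P = a := by
  obtain ⟨Q, rfl, rfl⟩ := hP
  rw [map_add, coeff_X_pow_mul', if_pos le_rfl, coeff_one, if_neg (by omega), zero_add]
  simp

theorem hasLeadingTerm_expSeries [Algebra ℝ A] (a : A) : HasLeadingTerm (expSeries a) 1 a := by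
  refine ⟨PowerSeries.mk fun n => (((n + 1).factorial : ℝ)⁻¹) • a ^ (n + 1), ?_, ?_⟩
  · ext n
    rw [map_add, coeff_X_pow_mul']
    rcases n with _ | n
    · simp [expSeries]
    · simp [expSeries, coeff_one]
  · rw [← coeff_zero_eq_constantCoeff_apply, coeff_mk]; simp

end PowerSeries

/-! ### Lie derivatives, brackets and words of vector fields -/

section SmoothFunctions

variable {E : Type*} [NormedAddCommGroup E] [NormedSpace ℝ E]

variable (E) in
/-- The space of smooth maps `E → E`, considered also as the space of vector fields on `E`. -/
def smoothMaps : Submodule ℝ (E → E) where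
  carrier := {f | ContDiff ℝ ∞ f}
  add_mem' {f g} hf hg := by
    change ContDiff ℝ ∞ (f + g)
    exact ContDiff.add hf hg
  zero_mem' := by
    change ContDiff ℝ ∞ (fun _ : E => (0 : E))
    exact contDiff_const
  smul_mem' c f hf := by
    change ContDiff ℝ ∞ (c • f)
    exact ContDiff.const_smul c hf

instance : CoeFun (smoothMaps E) (fun _ => E → E) := ⟨Subtype.val⟩

theorem contDiff_coe (V : smoothMaps E) : ContDiff ℝ ∞ (V : E → E) := V.2

theorem differentiable_coe (V : smoothMaps E) : Differentiable ℝ (V : E → E) :=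
  (contDiff_coe V).differentiable (by simp)

/-- The derivative of smooth functions along a vector field. -/
noncomputable def lieDerivative (V : smoothMaps E) : Module.End ℝ (smoothMaps E) where
  toFun f := ⟨fun x => fderiv ℝ f x (V x),
    ((contDiff_coe f).fderiv_right (m := ∞) (by simp)).clm_apply (contDiff_coe V)⟩
  map_add' f g := by
    ext x
    have := fderiv_add (differentiable_coe f x) (differentiable_coe g x)
    simp [this]
  map_smul' c f := by
    ext x
    have := fderiv_const_smul (differentiable_coe f x) c
    simp [this]

theorem lieDerivative_apply (V f : smoothMaps E) (x : E) :
    (lieDerivative V f : E → E) x = fderiv ℝ f x (V x) := rfl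

theorem lieDerivative_neg (V : smoothMaps E) : lieDerivative (-V) = -lieDerivative V := by
  ext f x
  simp [lieDerivative_apply]

/-- The Lie bracket of vector fields on `E`. -/
noncomputable def fieldBracket (V W : smoothMaps E) : smoothMaps E :=
  lieDerivative V W - lieDerivative W V

theorem coe_fieldBracket (V W : smoothMaps E) :
    (fieldBracket V W : E → E) = VectorField.lieBracket ℝ (V : E → E) W := rfl

/-- The second-order terms of the two compositions cancel by symmetry of the second derivative. -/
theorem lieDerivative_fieldBracket (V W : smoothMaps E) :
    lieDerivative (fieldBracket V W) =
      lieDerivative V * lieDerivative W - lieDerivative W * lieDerivative V := by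
  ext f x
  have hsymm : IsSymmSndFDerivAt ℝ (f : E → E) x :=
    (contDiff_coe f).contDiffAt.isSymmSndFDerivAt 
      (by simpa using WithTop.coe_le_coe.2 (le_top : (2 : ℕ∞) ≤ ⊤))
  have key : ∀ V W : smoothMaps E, (lieDerivative V (lieDerivative W f) : E → E) x =
      fderiv ℝ (fderiv ℝ (f : E → E)) x (V x) (W x) + fderiv ℝ f x (fderiv ℝ W x (V x)) := by
    intro V W
    have hd : DifferentiableAt ℝ (fderiv ℝ (f : E → E)) x :=
      (((contDiff_coe f).fderiv_right (m := ∞) (by simp)).differentiable (by simp)) x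
    have := fderiv_clm_apply hd (differentiable_coe W x)
    rw [lieDerivative_apply]
    change fderiv ℝ (fun y => fderiv ℝ (f : E → E) y (W y)) x (V x) = _
    rw [this]
    simp [add_comm]
  change fderiv ℝ (f : E → E) x (fderiv ℝ W x (V x) - fderiv ℝ V x (W x)) =
    (lieDerivative V (lieDerivative W f) : E → E) x - (lieDerivative W (lieDerivative V f) : E → E) x
  rw [key, key, hsymm.eq, map_sub]
  abel

/-- The vector fields obtained from those in `𝒢` by taking iterated Lie brackets. -/
inductive IsIteratedBracket (𝒢 : Set (smoothMaps E)) : smoothMaps E → Prop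
  | of {V : smoothMaps E} (hV : V ∈ 𝒢) : IsIteratedBracket 𝒢 V
  | bracket {V W : smoothMaps E} (hV : IsIteratedBracket 𝒢 V) (hW : IsIteratedBracket 𝒢 W) :
      IsIteratedBracket 𝒢 (fieldBracket V W)

/-- The operator series of the composition of the flows of a list of vector fields. -/
noncomputable def wordSeries (w : List (smoothMaps E)) : PowerSeries (Module.End ℝ (smoothMaps E)) :=
  (w.map fun V => expSeries (lieDerivative V)).prod

/-- The list of vector fields whose flows undo those of `w`. -/
def inverseWord (w : List (smoothMaps E)) : List (smoothMaps E) := (w.map fun V => -V).reverse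

theorem wordSeries_append (w w' : List (smoothMaps E)) :
    wordSeries (w ++ w') = wordSeries w * wordSeries w' := by
  simp [wordSeries]

theorem wordSeries_mul_inverseWord (w : List (smoothMaps E)) :
    wordSeries w * wordSeries (inverseWord w) = 1 := by
  induction w with
  | nil => simp [wordSeries, inverseWord]
  | cons V w ih =>
    have h1 : inverseWord (V :: w) = inverseWord w ++ [-V] := by simp [inverseWord]
    have h2 : wordSeries (V :: w) = expSeries (lieDerivative V) * wordSeries w := by
      simp [wordSeries]
    have h3 : wordSeries [-V] = expSeries (-lieDerivative V) := by
      simp [wordSeries, lieDerivative_neg]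
    rw [h1, h2, wordSeries_append, h3]
    calc _ = expSeries (lieDerivative V) * (wordSeries w * wordSeries (inverseWord w)) *
        expSeries (-lieDerivative V) := by noncomm_ring
      _ = 1 := by rw [ih, mul_one, expSeries_mul_neg]

theorem mem_of_mem_inverseWord {𝒢 : Set (smoothMaps E)} (hneg : ∀ V ∈ 𝒢, -V ∈ 𝒢)
    {w : List (smoothMaps E)} (hw : ∀ V ∈ w, V ∈ 𝒢) : ∀ V ∈ inverseWord w, V ∈ 𝒢 := by
  intro V hV
  obtain ⟨U, hU, rfl⟩ : ∃ U ∈ w, -U = V := by simpa [inverseWord] using hV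
  exact hneg U (hw U hU)

/-- A bracket is matched by the group commutator of the words of its two entries. Closure under
negation keeps the inverse words inside `𝒢`. -/
theorem IsIteratedBracket.exists_word {𝒢 : Set (smoothMaps E)} (hneg : ∀ V ∈ 𝒢, -V ∈ 𝒢)
    {Z : smoothMaps E} (hZ : IsIteratedBracket 𝒢 Z) :
    ∃ w : List (smoothMaps E), (∀ V ∈ w, V ∈ 𝒢) ∧
      ∃ r : ℕ, 1 ≤ r ∧ HasLeadingTerm (wordSeries w) r (lieDerivative Z) := by
  induction hZ with
  | @of V hV => exact ⟨[V], by simpa, 1, le_rfl, by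
      simpa [wordSeries] using hasLeadingTerm_expSeries (lieDerivative V)⟩
  | @bracket V W _ _ ihV ihW =>
    obtain ⟨v, hv, j, hj, hlv⟩ := ihV
    obtain ⟨w, hw, k, hk, hlw⟩ := ihW
    refine ⟨v ++ w ++ inverseWord v ++ inverseWord w, ?_, j + k, by omega, ?_⟩
    · intro U hU
      simp only [List.mem_append] at hU
      rcases hU with ((h | h) | h) | h
      · exact hv U h
      · exact hw U h
      · exact mem_of_mem_inverseWord hneg hv U h
      · exact mem_of_mem_inverseWord hneg hw U h
    · rw [wordSeries_append, wordSeries_append, wordSeries_append, lieDerivative_fieldBracket]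
      exact hlv.commutator hj hk hlw (wordSeries_mul_inverseWord v) (wordSeries_mul_inverseWord w)

end SmoothFunctions

/-! ### Taylor expansion of endpoints -/

section Taylor

variable {E : Type*} [NormedAddCommGroup E] [NormedSpace ℝ E]

/-- `y'` is the endpoint of an integral curve of `V` over `[0, s]` that starts at `y`. -/
def IsArc (V : smoothMaps E) (s : ℝ) (y y' : E) : Prop :=
  ∃ c : ℝ → E, c 0 = y ∧ c s = y' ∧ ∀ t ∈ Icc 0 s, HasDerivWithinAt c (V (c t)) (Icc 0 s) t

/-- `y'` is reached from `y` by following the fields of a list, each of them for the time `s`. -/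
def IsWordArc (s : ℝ) : List (smoothMaps E) → E → E → Prop
  | [], y, y' => y' = y
  | V :: w, y, y' => ∃ z, IsArc V s y z ∧ IsWordArc s w z y'

/-- Taylor's formula for a chain of successive derivatives `h k`. The induction applies the mean
value inequality to the remainder, whose derivative is the remainder of the shifted chain; no
factorial is needed in the bound. -/
theorem norm_sub_taylor_le {s C : ℝ} (hs : 0 ≤ s) (N : ℕ) (h : ℕ → ℝ → E)
    (hh : ∀ k, ∀ t ∈ Icc 0 s, HasDerivWithinAt (h k) (h (k + 1) t) (Icc 0 s) t)
    (hC : ∀ t ∈ Icc 0 s, ‖h (N + 1) t‖ ≤ C) :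
    ∀ t ∈ Icc 0 s, ‖h 0 t - ∑ j ∈ Finset.range (N + 1), (t ^ j * (j.factorial : ℝ)⁻¹) • h j 0‖
      ≤ C * t ^ (N + 1) := by
  have hC0 : 0 ≤ C := (norm_nonneg _).trans (hC 0 ⟨le_rfl, hs⟩)
  induction N generalizing h s with
  | zero =>
    intro t ht
    have := norm_image_sub_le_of_norm_deriv_le_segment' (hh 0)
      (fun x hx => hC x (Ico_subset_Icc_self hx)) t ht
    simpa using this
  | succ N ih =>
    intro t ht
    have hsub : Icc 0 t ⊆ Icc 0 s := Icc_subset_Icc_right ht.2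
    have hder : ∀ x ∈ Icc 0 t, HasDerivWithinAt
        (fun x => h 0 x - ∑ j ∈ Finset.range (N + 2), (x ^ j * (j.factorial : ℝ)⁻¹) • h j 0)
        (h 1 x - ∑ j ∈ Finset.range (N + 1), (x ^ j * (j.factorial : ℝ)⁻¹) • h (j + 1) 0)
        (Icc 0 t) x := by
      intro x hx
      refine ((hh 0 x (hsub hx)).mono hsub).sub ?_
      have h1 : ∀ j ∈ Finset.range (N + 1), HasDerivWithinAt
          (fun x : ℝ => (x ^ (j + 1) * ((j + 1).factorial : ℝ)⁻¹) • h (j + 1) 0)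
          ((x ^ j * (j.factorial : ℝ)⁻¹) • h (j + 1) 0) (Icc 0 t) x := by
        intro j _
        have h2 := (((hasDerivAt_pow (j + 1) x).mul_const
          (((j + 1).factorial : ℝ)⁻¹)).smul_const (h (j + 1) 0)).hasDerivWithinAt (s := Icc 0 t)
        convert h2 using 2
        have : (j.factorial : ℝ) ≠ 0 := by positivity
        rw [Nat.factorial_succ]
        push_cast
        field_simp
      have h3 := (HasDerivWithinAt.fun_sum h1).add_const (h 0 0)
      refine h3.congr_of_mem (fun y _ => ?_) hx
      rw [Finset.sum_range_succ']
      simp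
    have hb := norm_image_sub_le_of_norm_deriv_le_segment' hder (C := C * t ^ (N + 1))
      (fun x hx => ?_) t ⟨ht.1, le_rfl⟩
    · rw [Finset.sum_range_succ' _ (N + 1), Finset.sum_range_succ' _ (N + 1)] at hb
      rw [Finset.sum_range_succ' _ (N + 1)]
      simpa [pow_succ, mul_assoc] using hb
    · have hx' : x ∈ Icc 0 t := Ico_subset_Icc_self hx
      have := ih ht.1 (fun k => h (k + 1)) (fun k y hy => (hh (k + 1) y (hsub hy)).mono hsub)
        (fun y hy => hC y (hsub hy)) x hx'
      refine this.trans ?_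
      have := hx'.1
      gcongr
      exact hx'.2

/-- At least one derivative along `V` forces compact support. The function `f` itself may be
unbounded, as the identity is. -/
theorem lieDerivative_pow_succ_bounded {V : smoothMaps E} (hV : HasCompactSupport (V : E → E))
    (f : smoothMaps E) (n : ℕ) :
    ∃ C, ∀ x, ‖((lieDerivative V ^ (n + 1)) f : E → E) x‖ ≤ C := by
  rw [pow_succ', Module.End.mul_apply]
  set g := (lieDerivative V ^ n) f
  refine (contDiff_coe (lieDerivative V g)).continuous.bounded_above_of_compact_support ?_
  refine hV.mono fun x hx => ?_
  contrapose! hx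
  simp only [Function.mem_support, not_not] at hx ⊢
  simp [lieDerivative_apply, hx]

theorem exists_norm_arc_sub_le {V : smoothMaps E} (hV : HasCompactSupport (V : E → E))
    (f : smoothMaps E) (N : ℕ) :
    ∃ C, 0 ≤ C ∧ ∀ s y y', 0 ≤ s → IsArc V s y y' →
      ‖f y' - ∑ j ∈ Finset.range (N + 1),
        s ^ j • (PowerSeries.coeff j (expSeries (lieDerivative V)) f : E → E) y‖ ≤ C * s ^ (N + 1) := by
  obtain ⟨C, hC⟩ := lieDerivative_pow_succ_bounded hV f N
  refine ⟨C, (norm_nonneg _).trans (hC 0), ?_⟩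
  rintro s y y' hs ⟨c, rfl, rfl, hc⟩
  have := norm_sub_taylor_le hs N (fun k t => ((lieDerivative V ^ k) f : E → E) (c t)) (C := C)
    (fun k t ht => ?_) (fun t _ => hC _) s ⟨hs, le_rfl⟩
  · simpa [expSeries, mul_smul] using this
  · rw [pow_succ', Module.End.mul_apply, lieDerivative_apply]
    exact ((differentiable_coe _ (c t)).hasFDerivAt.comp_hasDerivWithinAt t (hc t ht))

theorem coeff_mul_eval (P Q : PowerSeries (Module.End ℝ (smoothMaps E))) (f : smoothMaps E)
    (y : E) (s : ℝ) (N : ℕ) :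
    ∑ n ∈ Finset.range N, s ^ n • (PowerSeries.coeff n (P * Q) f : E → E) y =
      ∑ j ∈ Finset.range N, s ^ j • ∑ i ∈ Finset.range (N - j),
        s ^ i • (PowerSeries.coeff i P (PowerSeries.coeff j Q f) : E → E) y := by
  have h1 := Finset.sum_range_diag_flip N (fun j i =>
    s ^ j • s ^ i • (PowerSeries.coeff i P (PowerSeries.coeff j Q f) : E → E) y)
  simp only [Finset.smul_sum]
  rw [← h1]
  refine Finset.sum_congr rfl fun n _ => ?_
  rw [PowerSeries.coeff_mul, ← Finset.Nat.sum_antidiagonal_swap,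
    Finset.Nat.sum_antidiagonal_eq_sum_range_succ_mk]
  simp only [LinearMap.sum_apply, Submodule.coe_sum, Finset.sum_apply, Finset.smul_sum,
    Module.End.mul_apply, Prod.swap]
  refine Finset.sum_congr rfl fun k hk => ?_
  rw [smul_smul, ← pow_add]
  congr 2
  have := Finset.mem_range.1 hk
  omega

/-- The tail of the word is expanded at the intermediate point `z`. Each coefficient of that
expansion is again a smooth map, so it is expanded along the first arc, to order `N - j` because it
already carries `s ^ j`. This is why `f` is arbitrary here. -/
theorem exists_norm_wordArc_sub_le {w : List (smoothMaps E)}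
    (hw : ∀ V ∈ w, HasCompactSupport (V : E → E)) (f : smoothMaps E) (N : ℕ) :
    ∃ C, 0 ≤ C ∧ ∀ s y y', 0 ≤ s → IsWordArc s w y y' →
      ‖f y' - ∑ j ∈ Finset.range (N + 1),
        s ^ j • (PowerSeries.coeff j (wordSeries w) f : E → E) y‖ ≤ C * s ^ (N + 1) := by
  induction w with
  | nil =>
    refine ⟨0, le_rfl, ?_⟩
    rintro s y y' - rfl
    rw [Finset.sum_range_succ']
    simp [wordSeries, PowerSeries.coeff_one]
  | cons V w ih =>
    obtain ⟨C, hC0, hC⟩ := ih fun U hU => hw U (List.mem_cons_of_mem _ hU)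
    choose D hD0 hD using fun j : ℕ => exists_norm_arc_sub_le (hw V List.mem_cons_self)
      (PowerSeries.coeff j (wordSeries w) f) (N - j)
    refine ⟨C + ∑ j ∈ Finset.range (N + 1), D j,
      add_nonneg hC0 (Finset.sum_nonneg fun j _ => hD0 j), ?_⟩
    rintro s y y' hs ⟨z, hyz, hzy⟩
    have hws : wordSeries (V :: w) = expSeries (lieDerivative V) * wordSeries w := by
      simp [wordSeries]
    rw [hws, coeff_mul_eval]
    refine (norm_sub_le_norm_sub_add_norm_sub _ (∑ j ∈ Finset.range (N + 1),
        s ^ j • (PowerSeries.coeff j (wordSeries w) f : E → E) z) _).trans ?_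
    rw [add_mul, Finset.sum_mul, ← Finset.sum_sub_distrib]
    refine add_le_add (hC s z y' hs hzy) ((norm_sum_le _ _).trans (Finset.sum_le_sum ?_))
    intro j hj
    have hj' : j ≤ N := by have := Finset.mem_range.1 hj; omega
    have e : N + 1 - j = N - j + 1 := by omega
    rw [← smul_sub, norm_smul, e, Real.norm_of_nonneg (by positivity)]
    calc s ^ j * _ ≤ s ^ j * (D j * s ^ (N - j + 1)) := by
          gcongr; exact hD j s y z hs hyz
      _ = D j * s ^ (N + 1) := by
          rw [mul_left_comm, ← pow_add]; congr 2; omega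

/-- The word series `1 + L_Z Xʳ + …` governs the displacement of the endpoint to order `r`. -/
theorem exists_norm_displacement_sub_le {w : List (smoothMaps E)}
    (hw : ∀ V ∈ w, HasCompactSupport (V : E → E)) {r : ℕ} (hr : 1 ≤ r) {Z : smoothMaps E}
    (hZ : HasLeadingTerm (wordSeries w) r (lieDerivative Z)) :
    ∃ C, 0 ≤ C ∧ ∀ s y y', 0 ≤ s → IsWordArc s w y y' →
      ‖y' - y - s ^ r • Z y‖ ≤ C * s ^ (r + 1) := by
  -- The identity serves as test function: its value at `y'` is the endpoint itself.
  let f : smoothMaps E := ⟨id, show ContDiff ℝ ∞ (id : E → E) from contDiff_id⟩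
  obtain ⟨C, hC0, hC⟩ := exists_norm_wordArc_sub_le hw f r
  refine ⟨C, hC0, fun s y y' hs h => ?_⟩
  have h1 := hC s y y' hs h
  obtain ⟨r, rfl⟩ : ∃ k, r = k + 1 := ⟨r - 1, by omega⟩
  rw [Finset.sum_range_succ, Finset.sum_range_succ', hZ.coeff_self hr, hZ.coeff_zero hr,
    Finset.sum_eq_zero] at h1
  · have h2 : (lieDerivative Z f : E → E) y = Z y := by
      rw [lieDerivative_apply]; change fderiv ℝ id y (Z y) = _; simp
    rw [h2] at h1
    have h3 : (f : E → E) y' - (0 + s ^ 0 • ((1 : Module.End ℝ (smoothMaps E)) f : E → E) y +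
        s ^ (r + 1) • Z y) = y' - y - s ^ (r + 1) • Z y := by
      change y' - (0 + s ^ 0 • y + s ^ (r + 1) • Z y) = _
      rw [pow_zero, one_smul]; abel
    rwa [h3] at h1
  · intro k hk
    rw [hZ.coeff_of_lt (by omega) (by have := Finset.mem_range.1 hk; omega)]
    simp

end Taylor

/-! ### Trajectories and their infinite concatenation -/

section Trajectories

theorem lipschitzWith_of_Iic_of_Ici {F : Type*} [PseudoMetricSpace F] {K : NNReal} {c : ℝ → F} {T : ℝ}
    (h₁ : LipschitzOnWith K c (Iic T))
    (h₂ : LipschitzOnWith K c (Ici T)) : LipschitzWith K c := by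
  have key : ∀ x y, x ≤ y → dist (c x) (c y) ≤ K * dist x y := by
    intro x y hxy
    rcases le_total y T with hy | hy
    · exact h₁.dist_le_mul x (hxy.trans hy) y hy
    rcases le_total T x with hx | hx
    · exact h₂.dist_le_mul x hx y hy
    have a := h₁.dist_le_mul x hx T self_mem_Iic
    have b := h₂.dist_le_mul T self_mem_Ici y hy
    have e : dist x y = dist x T + dist T y := by
      rw [Real.dist_eq, Real.dist_eq, Real.dist_eq, abs_of_nonpos, abs_of_nonpos, abs_of_nonpos] <;>
        linarith
    rw [e, mul_add]
    exact (dist_triangle _ _ _).trans (add_le_add a b)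
  refine LipschitzWith.of_dist_le_mul fun x y => ?_
  rcases le_total x y with h | h
  · exact key x y h
  · rw [dist_comm, dist_comm x y]; exact key y x h

variable {E : Type*} [NormedAddCommGroup E] [NormedSpace ℝ E]

/-- `c` is a `K`-Lipschitz curve from `y` to `y'`, constant outside `[0, T]`, whose velocity is the
value of some member of `𝓕` at all but countably many times in `(0, T)`. -/
structure IsTrajectory (𝓕 : Set (smoothMaps E)) (K : NNReal) (c : ℝ → E) (T : ℝ) (y y' : E) :
    Prop where
  nonneg : 0 ≤ T
  lipschitz : LipschitzWith K c
  left : ∀ t ≤ 0, c t = y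
  right : ∀ t, T ≤ t → c t = y'
  deriv : ∃ S : Set ℝ, S.Countable ∧ ∀ t ∈ Ioo 0 T, t ∉ S → ∃ V ∈ 𝓕, HasDerivAt c (V (c t)) t

/-- `y'` is reached from `y` in time `T` by a trajectory of `𝓕`. -/
def Reaches (𝓕 : Set (smoothMaps E)) (K : NNReal) (T : ℝ) (y y' : E) : Prop :=
  ∃ c, IsTrajectory 𝓕 K c T y y'

variable {𝓕 : Set (smoothMaps E)} {K : NNReal}

theorem IsTrajectory.const (y : E) : IsTrajectory 𝓕 K (fun _ => y) 0 y y where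
  nonneg := le_rfl
  lipschitz := LipschitzWith.const' y
  left _ _ := rfl
  right _ _ := rfl
  deriv := ⟨∅, countable_empty, fun _ ht => absurd (ht.1.trans ht.2) (lt_irrefl _)⟩

/-- Follow `c₁` until time `T`, then `c₂`. -/
noncomputable def concatCurve (c₁ : ℝ → E) (T : ℝ) (c₂ : ℝ → E) : ℝ → E :=
  fun t => if t ≤ T then c₁ t else c₂ (t - T)

theorem IsTrajectory.concat {c₁ c₂ : ℝ → E} {T₁ T₂ : ℝ} {x y z : E}
    (h₁ : IsTrajectory 𝓕 K c₁ T₁ x y) (h₂ : IsTrajectory 𝓕 K c₂ T₂ y z) :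
    IsTrajectory 𝓕 K (concatCurve c₁ T₁ c₂) (T₁ + T₂) x z where
  nonneg := add_nonneg h₁.nonneg h₂.nonneg
  lipschitz := by
    refine lipschitzWith_of_Iic_of_Ici (T := T₁) ?_ ?_
    · refine LipschitzOnWith.of_dist_le_mul fun a ha b hb => ?_
      rw [concatCurve, concatCurve, if_pos (mem_Iic.1 ha), if_pos (mem_Iic.1 hb)]
      exact h₁.lipschitz.dist_le_mul a b
    · have e : ∀ t ∈ Ici T₁, concatCurve c₁ T₁ c₂ t = c₂ (t - T₁) := by
        intro t ht
        rw [concatCurve]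
        split_ifs with h
        · obtain rfl : t = T₁ := le_antisymm h ht
          rw [h₁.right _ le_rfl, h₂.left _ (by simp)]
        · rfl
      refine LipschitzOnWith.of_dist_le_mul fun a ha b hb => ?_
      rw [e a ha, e b hb]
      simpa using h₂.lipschitz.dist_le_mul (a - T₁) (b - T₁)
  left t ht := by rw [concatCurve, if_pos (ht.trans h₁.nonneg), h₁.left t ht]
  right t ht := by
    rw [concatCurve]
    split_ifs with h
    · have := h₂.nonneg
      rw [h₁.right t (by linarith), ← h₂.left 0 le_rfl, h₂.right 0 (by linarith)]
    · exact h₂.right _ (by linarith)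
  deriv := by
    obtain ⟨S₁, hS₁, hd₁⟩ := h₁.deriv
    obtain ⟨S₂, hS₂, hd₂⟩ := h₂.deriv
    refine ⟨S₁ ∪ {T₁} ∪ (fun t => t + T₁) '' S₂,
      (hS₁.union (countable_singleton _)).union (hS₂.image _), fun t ht hS => ?_⟩
    simp only [mem_union, mem_singleton_iff, not_or] at hS
    rcases lt_or_gt_of_ne hS.1.2 with h | h
    · obtain ⟨V, hV, hVd⟩ := hd₁ t ⟨ht.1, h⟩ hS.1.1
      refine ⟨V, hV, ?_⟩
      have e : concatCurve c₁ T₁ c₂ =ᶠ[𝓝 t] c₁ := by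
        filter_upwards [Iio_mem_nhds h] with u hu
        rw [concatCurve, if_pos (le_of_lt hu)]
      rw [e.eq_of_nhds]
      exact hVd.congr_of_eventuallyEq e
    · obtain ⟨V, hV, hVd⟩ := hd₂ (t - T₁) ⟨by linarith, by linarith [ht.2]⟩
        (fun h => hS.2 ⟨_, h, by simp⟩)
      refine ⟨V, hV, ?_⟩
      have e : concatCurve c₁ T₁ c₂ =ᶠ[𝓝 t] fun u => c₂ (u - T₁) := by
        filter_upwards [Ioi_mem_nhds h] with u hu
        rw [concatCurve, if_neg (not_le_of_gt hu)]
      rw [e.eq_of_nhds]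
      exact (hVd.comp_sub_const t T₁).congr_of_eventuallyEq e

theorem Reaches.refl (y : E) : Reaches 𝓕 K 0 y y := ⟨_, IsTrajectory.const y⟩

theorem Reaches.trans {T₁ T₂ : ℝ} {x y z : E} (h₁ : Reaches 𝓕 K T₁ x y)
    (h₂ : Reaches 𝓕 K T₂ y z) : Reaches 𝓕 K (T₁ + T₂) x z := by
  obtain ⟨c₁, h₁⟩ := h₁
  obtain ⟨c₂, h₂⟩ := h₂
  exact ⟨_, h₁.concat h₂⟩

theorem Reaches.norm_sub_le {T : ℝ} {y y' : E} (h : Reaches 𝓕 K T y y') : ‖y' - y‖ ≤ K * T := by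
  obtain ⟨c, hc⟩ := h
  have := hc.lipschitz.dist_le_mul T 0
  rwa [hc.right T le_rfl, hc.left 0 le_rfl, dist_eq_norm, dist_zero_right,
    Real.norm_of_nonneg hc.nonneg] at this

theorem Reaches.nonneg {T : ℝ} {y y' : E} (h : Reaches 𝓕 K T y y') : 0 ≤ T := by
  obtain ⟨c, hc⟩ := h
  exact hc.nonneg

theorem IsArc.reaches {V : smoothMaps E} (hV : V ∈ 𝓕) (hK : ∀ x, ‖V x‖ ≤ K) {s : ℝ} (hs : 0 ≤ s)
    {y y' : E} (h : IsArc V s y y') : Reaches 𝓕 K s y y' := by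
  obtain ⟨c, h0, h1, hc⟩ := h
  -- Projecting time to `[0, s]` extends the arc by constants.
  refine ⟨fun t => c (projIcc 0 s hs t), hs, ?_, ?_, ?_, ∅, countable_empty, ?_⟩
  · have hl : LipschitzOnWith K c (Icc 0 s) :=
      (convex_Icc 0 s).lipschitzOnWith_of_nnnorm_hasDerivWithin_le hc fun t _ => hK _
    have := hl.to_restrict.comp (LipschitzWith.projIcc hs)
    simpa using! this
  · intro t ht
    simp [projIcc_of_le_left hs ht, h0]
  · intro t ht
    simp [projIcc_of_right_le hs ht, h1]
  · intro t ht _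
    refine ⟨V, hV, ?_⟩
    have e : (fun t => c (projIcc 0 s hs t)) =ᶠ[𝓝 t] c := by
      filter_upwards [Ioo_mem_nhds ht.1 ht.2] with u hu
      simp [projIcc_of_mem hs (Ioo_subset_Icc_self hu)]
    have e' : c (projIcc 0 s hs t) = c t := e.eq_of_nhds
    simp only [e']
    exact ((hc t (Ioo_subset_Icc_self ht)).hasDerivAt (Icc_mem_nhds ht.1 ht.2)).congr_of_eventuallyEq e

theorem IsWordArc.reaches {s : ℝ} (hs : 0 ≤ s) (hK : ∀ V ∈ 𝓕, ∀ x, ‖V x‖ ≤ K)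
    {w : List (smoothMaps E)} (hw : ∀ V ∈ w, V ∈ 𝓕) {y y' : E} (h : IsWordArc s w y y') :
    Reaches 𝓕 K (w.length * s) y y' := by
  induction w generalizing y with
  | nil =>
    obtain rfl : y' = y := h
    simpa using Reaches.refl y'
  | cons V w ih =>
    obtain ⟨z, hyz, hz⟩ := h
    have hV := hw V List.mem_cons_self
    have := (hyz.reaches hV (hK V hV) hs).trans
      (ih (fun U hU => hw U (List.mem_cons_of_mem _ hU)) hz)
    convert this using 1
    push_cast [List.length_cons]
    ring

/-- Compact support makes `V` globally bounded and Lipschitz, so Picard–Lindelöf applies on a ball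
of radius `B * s`, with no restriction on `s`. -/
theorem exists_isArc [FiniteDimensional ℝ E] {V : smoothMaps E} (hV : HasCompactSupport (V : E → E))
    {s : ℝ} (hs : 0 ≤ s) (y : E) : ∃ y', IsArc V s y y' := by
  have := FiniteDimensional.complete ℝ E
  obtain ⟨L, hL⟩ := (contDiff_coe V).lipschitzWith_of_hasCompactSupport hV (by simp)
  obtain ⟨B, hB⟩ := (contDiff_coe V).continuous.bounded_above_of_compact_support hV
  have hB0 : 0 ≤ B := (norm_nonneg _).trans (hB 0)
  have hpl : IsPicardLindelof (fun _ => (V : E → E)) (⟨0, le_rfl, hs⟩ : Icc 0 s) y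
      ⟨B * s, by positivity⟩ 0 ⟨B, hB0⟩ L := by
    refine IsPicardLindelof.of_time_independent (fun x _ => hB x) hL.lipschitzOnWith ?_
    simpa [hs] using! le_rfl
  obtain ⟨c, hc0, hc⟩ := hpl.exists_eq_forall_mem_Icc_hasDerivWithinAt₀
  exact ⟨c s, c, hc0, rfl, hc⟩

theorem exists_isWordArc [FiniteDimensional ℝ E] {w : List (smoothMaps E)}
    (hw : ∀ V ∈ w, HasCompactSupport (V : E → E)) {s : ℝ} (hs : 0 ≤ s) (y : E) :
    ∃ y', IsWordArc s w y y' := by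
  induction w generalizing y with
  | nil => exact ⟨y, rfl⟩
  | cons V w ih =>
    obtain ⟨z, hz⟩ := exists_isArc (hw V List.mem_cons_self) hs y
    obtain ⟨y', hy'⟩ := ih (fun U hU => hw U (List.mem_cons_of_mem _ hU)) z
    exact ⟨y', z, hz, hy'⟩

/-- An infinite concatenation of trajectories, of finite total duration, is a trajectory. -/
theorem Reaches.of_hasSum {y : ℕ → E} {q : E} {τ : ℕ → ℝ} {T : ℝ}
    (h : ∀ n, Reaches 𝓕 K (τ n) (y n) (y (n + 1))) (hτ : HasSum τ T)
    (hy : Filter.Tendsto y Filter.atTop (𝓝 q)) : Reaches 𝓕 K T (y 0) q := by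
  choose c hc using h
  have hτ0 : ∀ n, 0 ≤ τ n := fun n => (hc n).nonneg
  set t : ℕ → ℝ := fun n => ∑ i ∈ Finset.range n, τ i with ht_def
  have ht_mono : Monotone t := monotone_nat_of_le_succ fun n => by
    simp only [ht_def, Finset.sum_range_succ]; linarith [hτ0 n]
  have ht_lim : Filter.Tendsto t Filter.atTop (𝓝 T) := hτ.tendsto_sum_nat
  have ht_le : ∀ n, t n ≤ T := fun n => ht_mono.ge_of_tendsto ht_lim n
  -- `C n` follows the first `n` trajectories and then rests at `y n`. At a time before some `t n`
  -- the sequence is eventually constant; at a time beyond all `t n` it equals `y n`, which tends to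
  -- `q`.
  let C : ℕ → ℝ → E := fun n => Nat.rec (fun _ => y 0) (fun n d => concatCurve d (t n) (c n)) n
  have hC : ∀ n, IsTrajectory 𝓕 K (C n) (t n) (y 0) (y n) := by
    intro n
    induction n with
    | zero => simpa [C, t] using IsTrajectory.const (y 0)
    | succ n ih =>
      have := ih.concat (hc n)
      simpa [C, t, Finset.sum_range_succ] using this
  have hstep : ∀ n, ∀ u ≤ t n, C (n + 1) u = C n u := by
    intro n u hu
    change concatCurve (C n) (t n) (c n) u = _
    rw [concatCurve, if_pos hu]
  have hconst : ∀ n m, n ≤ m → ∀ u ≤ t n, C m u = C n u := by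
    intro n m hnm
    induction m, hnm using Nat.le_induction with
    | base => exact fun _ _ => rfl
    | succ m hm ih =>
      intro u hu
      rw [hstep m u (hu.trans (ht_mono hm)), ih u hu]
  have hlim_lt : ∀ n, ∀ u ≤ t n, Filter.Tendsto (fun m => C m u) Filter.atTop (𝓝 (C n u)) := by
    intro n u hu
    refine tendsto_const_nhds.congr' ?_
    filter_upwards [Filter.eventually_ge_atTop n] with m hm
    exact (hconst n m hm u hu).symm
  have hlim_ge : ∀ u, (∀ n, t n ≤ u) → Filter.Tendsto (fun m => C m u) Filter.atTop (𝓝 q) := by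
    intro u hu
    exact hy.congr fun n => ((hC n).right u (hu n)).symm
  have hex : ∀ u, ∃ z, Filter.Tendsto (fun m => C m u) Filter.atTop (𝓝 z) := by
    intro u
    by_cases hu : ∃ n, u ≤ t n
    · obtain ⟨n, hn⟩ := hu
      exact ⟨_, hlim_lt n u hn⟩
    · push Not at hu
      exact ⟨_, hlim_ge u fun n => (hu n).le⟩
  choose D hD using hex
  have hDC : ∀ n, ∀ u ≤ t n, D u = C n u := fun n u hu =>
    tendsto_nhds_unique (hD u) (hlim_lt n u hu)
  refine ⟨D, hτ.nonneg hτ0, ?_, ?_, ?_, ?_⟩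
  · refine LipschitzWith.of_dist_le_mul fun u v => ?_
    exact le_of_tendsto ((hD u).dist (hD v))
      (Filter.Eventually.of_forall fun n => (hC n).lipschitz.dist_le_mul u v)
  · intro u hu
    rw [hDC 0 u (by simpa [t] using hu), (hC 0).left u hu]
  · intro u hu
    exact tendsto_nhds_unique (hD u) (hlim_ge u fun n => (ht_le n).trans hu)
  · choose S hS hd using fun n => (hC n).deriv
    refine ⟨⋃ n, S n, countable_iUnion hS, fun u hu huS => ?_⟩
    obtain ⟨n, hn⟩ := (ht_lim.eventually (lt_mem_nhds hu.2)).exists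
    obtain ⟨V, hV, hVd⟩ := hd n u ⟨hu.1, hn⟩ fun h => huS (mem_iUnion_of_mem n h)
    have e : D =ᶠ[𝓝 u] C n := by
      filter_upwards [Iio_mem_nhds hn] with v hv
      exact hDC n v (le_of_lt hv)
    refine ⟨V, hV, ?_⟩
    rw [e.eq_of_nhds]
    exact hVd.congr_of_eventuallyEq e

end Trajectories

/-! ### Approximate moves and exact local controllability -/

section LocalControllability

theorem exists_pos_forall_le_of_finite {ι : Type*} [Finite ι] (f : ι → ℝ) (hf : ∀ i, 0 < f i) :
    ∃ a > 0, ∀ i, a ≤ f i := by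
  have h : ∀ᶠ a : ℝ in 𝓝[>] 0, ∀ i, a ≤ f i := Filter.eventually_all.2 fun i =>
    Filter.Eventually.filter_mono nhdsWithin_le_nhds (Iic_mem_nhds (hf i))
  obtain ⟨a, ha, h⟩ := (eventually_mem_nhdsWithin.and h).exists
  exact ⟨a, ha, h⟩

variable {E : Type*} [NormedAddCommGroup E] [NormedSpace ℝ E]

/-- Following a word with leading term `L_Z X^r`, one moves approximately in the direction
`Z p`, uniformly in the starting point near `p`. -/
theorem exists_move [FiniteDimensional ℝ E] {𝓕 : Set (smoothMaps E)} {K : NNReal} (hK : ∀ V ∈ 𝓕, ∀ x, ‖V x‖ ≤ K)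
    (hcs : ∀ V ∈ 𝓕, HasCompactSupport (V : E → E)) {w : List (smoothMaps E)}
    (hw : ∀ V ∈ w, V ∈ 𝓕) {r : ℕ} (hr : 1 ≤ r) {Z : smoothMaps E}
    (hZ : HasLeadingTerm (wordSeries w) r (lieDerivative Z)) (p : E) {η : ℝ} (hη : 0 < η) :
    ∃ ρ > 0, ∃ s₀ > 0, ∀ y, ‖y - p‖ < ρ → ∀ s, 0 ≤ s → s ≤ s₀ →
      ∃ y', Reaches 𝓕 K (w.length * s) y y' ∧ ‖y' - y - s ^ r • Z p‖ ≤ η * s ^ r := by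
  obtain ⟨C, hC0, hC⟩ := exists_norm_displacement_sub_le (fun V hV => hcs V (hw V hV)) hr hZ
  obtain ⟨ρ, hρ, hρZ⟩ := Metric.continuous_iff.1 (contDiff_coe Z).continuous p (η / 2) (by positivity)
  -- Half of `η` absorbs the remainder `C * s ^ (r + 1)`, the other half the variation of `Z` near
  -- `p`.
  refine ⟨ρ, hρ, η / (2 * (C + 1)), by positivity, fun y hy s hs hs₀ => ?_⟩
  obtain ⟨y', hy'⟩ := exists_isWordArc (fun V hV => hcs V (hw V hV)) hs y
  refine ⟨y', hy'.reaches hs hK hw, ?_⟩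
  have h1 := hC s y y' hs hy'
  have h2 : ‖Z y - Z p‖ ≤ η / 2 := by
    rw [← dist_eq_norm]; exact (hρZ y (by rwa [dist_eq_norm])).le
  have h3 : y' - y - s ^ r • Z p = (y' - y - s ^ r • Z y) + s ^ r • (Z y - Z p) := by
    rw [smul_sub]; abel
  have h4 : C * s ≤ η / 2 := by
    calc C * s ≤ (C + 1) * (η / (2 * (C + 1))) := by gcongr; linarith
      _ = η / 2 := by field_simp
  rw [h3]
  refine (norm_add_le _ _).trans ?_
  rw [norm_smul, Real.norm_of_nonneg (by positivity)]
  calc _ ≤ C * s ^ (r + 1) + s ^ r * (η / 2) := by gcongr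
    _ = (C * s) * s ^ r + s ^ r * (η / 2) := by ring
    _ ≤ (η / 2) * s ^ r + s ^ r * (η / 2) := by gcongr
    _ = η * s ^ r := by ring

/-- The same with a prescribed signed displacement `c • Z p`. -/
theorem exists_signed_move [FiniteDimensional ℝ E] {𝓕 : Set (smoothMaps E)} {K : NNReal} (hK : ∀ V ∈ 𝓕, ∀ x, ‖V x‖ ≤ K)
    (hcs : ∀ V ∈ 𝓕, HasCompactSupport (V : E → E)) {w : List (smoothMaps E)}
    (hw : ∀ V ∈ w, V ∈ 𝓕) (hw' : ∀ V ∈ inverseWord w, V ∈ 𝓕) {r N : ℕ} (hr : 1 ≤ r) (hN : r ≤ N)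
    {Z : smoothMaps E} (hZ : HasLeadingTerm (wordSeries w) r (lieDerivative Z)) (p : E) {η : ℝ}
    (hη : 0 < η) :
    ∃ ρ > 0, ∃ s₀ > 0, ∀ y, ‖y - p‖ < ρ → ∀ s, 0 ≤ s → s ≤ s₀ → ∀ c : ℝ, |c| ≤ s ^ N →
      ∃ y' T, T ≤ w.length * s ∧ Reaches 𝓕 K T y y' ∧ ‖y' - y - c • Z p‖ ≤ η * |c| := by
  have hZ' : HasLeadingTerm (wordSeries (inverseWord w)) r (lieDerivative (-Z)) := by
    rw [lieDerivative_neg]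
    exact hZ.inv hr (wordSeries_mul_inverseWord w)
  obtain ⟨ρ₁, hρ₁, s₁, hs₁, h₁⟩ := exists_move hK hcs hw hr hZ p hη
  obtain ⟨ρ₂, hρ₂, s₂, hs₂, h₂⟩ := exists_move hK hcs hw' hr hZ' p hη
  have hlen : (inverseWord w).length = w.length := by simp [inverseWord]
  refine ⟨min ρ₁ ρ₂, lt_min hρ₁ hρ₂, min 1 (min s₁ s₂), lt_min one_pos (lt_min hs₁ hs₂), ?_⟩
  intro y hy s hs hss c hc
  have hs1 : s ≤ 1 := hss.trans (min_le_left _ _)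
  have hss₁ : s ≤ s₁ := hss.trans ((min_le_right _ _).trans (min_le_left _ _))
  have hss₂ : s ≤ s₂ := hss.trans ((min_le_right _ _).trans (min_le_right _ _))
  -- The word of order `r` run for time `|c| ^ (1 / r)` per letter displaces by about `|c|`. As `s ≤
  -- 1` and `r ≤ N`, this time is at most `s`, so one exponent `N` can serve all directions.
  obtain ⟨σ, hσ0, hσ⟩ : ∃ σ : ℝ, 0 ≤ σ ∧ σ ^ r = |c| :=
    ⟨|c| ^ ((r : ℝ)⁻¹), by positivity, Real.rpow_inv_natCast_pow (abs_nonneg c) (by omega)⟩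
  have hσs : σ ≤ s := by
    refine le_of_pow_le_pow_left₀ (by omega : r ≠ 0) hs ?_
    rw [hσ]
    exact hc.trans (pow_le_pow_of_le_one hs hs1 hN)
  rcases le_total 0 c with h0 | h0
  · obtain ⟨y', hR, hy'⟩ := h₁ y (hy.trans_le (min_le_left _ _)) σ hσ0 (hσs.trans hss₁)
    rw [hσ] at hy'
    refine ⟨y', _, by gcongr, hR, ?_⟩
    rwa [abs_of_nonneg h0] at hy' ⊢
  · obtain ⟨y', hR, hy'⟩ := h₂ y (hy.trans_le (min_le_right _ _)) σ hσ0 (hσs.trans hss₂)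
    rw [hσ] at hy'
    refine ⟨y', _, by rw [hlen]; gcongr, hR, ?_⟩
    rw [abs_of_nonpos h0] at hy' ⊢
    simpa using hy'

/-- Moves along a basis of directions, one after the other. -/
theorem exists_move_sum {ι : Type*} [Fintype ι] {𝓕 : Set (smoothMaps E)} {K : NNReal} {p : E}
    {b : ι → E} {N : ℕ} {D : ℝ} (hD : 0 ≤ D)
    (hmove : ∀ i, ∀ η > 0, ∃ ρ > 0, ∃ s₀ > 0, ∀ y, ‖y - p‖ < ρ → ∀ s, 0 ≤ s → s ≤ s₀ →
      ∀ c : ℝ, |c| ≤ s ^ N → ∃ y' T, T ≤ D * s ∧ Reaches 𝓕 K T y y' ∧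
        ‖y' - y - c • b i‖ ≤ η * |c|) {η : ℝ} (hη : 0 < η) :
    ∃ ρ > 0, ∃ s₀ > 0, ∀ y, ‖y - p‖ < ρ → ∀ s, 0 ≤ s → s ≤ s₀ →
      ∀ c : ι → ℝ, (∀ i, |c i| ≤ s ^ N) → ∃ y' T, T ≤ Fintype.card ι * D * s ∧ Reaches 𝓕 K T y y' ∧
        ‖y' - y - ∑ i, c i • b i‖ ≤ η * ∑ i, |c i| := by
  choose ρ hρ s₀ hs₀ h using fun i => hmove i η hη
  obtain ⟨ρ', hρ', hρρ⟩ : ∃ ρ' > 0, ∀ i, ρ' ≤ ρ i := exists_pos_forall_le_of_finite ρ hρ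
  obtain ⟨s', hs', hss⟩ : ∃ s' > 0, ∀ i, s' ≤ s₀ i := exists_pos_forall_le_of_finite s₀ hs₀
  set M : ℝ := K * (Fintype.card ι * D) with hM
  have hM0 : 0 ≤ M := by positivity
  -- `M * s` bounds the drift during the whole sequence of moves; with `s` this small every
  -- intermediate point stays within `ρ'` of `p`.
  refine ⟨ρ' / 2, by positivity, min s' (ρ' / (4 * (M + 1))), by positivity, ?_⟩
  intro y hy s hs hss' c hc
  have hMs : M * s < ρ' / 2 := by
    calc M * s ≤ (M + 1) * (ρ' / (4 * (M + 1))) := by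
          gcongr
          · linarith
          · exact hss'.trans (min_le_right _ _)
      _ = ρ' / 4 := by field_simp
      _ < ρ' / 2 := by linarith
  have key : ∀ t : Finset ι, ∃ y' T, T ≤ t.card * D * s ∧ Reaches 𝓕 K T y y' ∧
      ‖y' - y - ∑ i ∈ t, c i • b i‖ ≤ η * ∑ i ∈ t, |c i| := by
    classical
    intro t
    induction t using Finset.induction_on with
    | empty => exact ⟨y, 0, by simp, Reaches.refl y, by simp⟩
    | insert i t hi ih =>
      obtain ⟨z, T, hT, hR, hz⟩ := ih
      have hzp : ‖z - p‖ < ρ i := by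
        have h1 := hR.norm_sub_le
        have h2 : (K : ℝ) * T ≤ M * s := by
          calc (K : ℝ) * T ≤ K * (t.card * D * s) := by gcongr
            _ ≤ K * (Fintype.card ι * D * s) := by gcongr; exact Finset.card_le_univ t
            _ = M * s := by rw [hM]; ring
        have h3 := norm_sub_le_norm_sub_add_norm_sub z y p
        linarith [hρρ i]
      obtain ⟨y', T', hT', hR', hy'⟩ := h i z hzp s hs
        ((hss'.trans (min_le_left _ _)).trans (hss i)) (c i) (hc i)
      refine ⟨y', T + T', ?_, hR.trans hR', ?_⟩
      · rw [Finset.card_insert_of_notMem hi]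
        push_cast
        linarith
      · rw [Finset.sum_insert hi, Finset.sum_insert hi]
        have e : y' - y - (c i • b i + ∑ j ∈ t, c j • b j) =
            (y' - z - c i • b i) + (z - y - ∑ j ∈ t, c j • b j) := by abel
        rw [e, mul_add]
        exact (norm_add_le _ _).trans (add_le_add hy' hz)
  simpa using key Finset.univ

/-- If approximate moves at all scales exist near `p`, the points near `p` are reached exactly. -/
theorem exists_reaches_of_contraction {𝓕 : Set (smoothMaps E)} {K : NNReal} {p : E} {N : ℕ}
    (hN : 1 ≤ N) {ρ s₀ κ D : ℝ} (hρ : 0 < ρ) (hs₀ : 0 < s₀) (hκ : 0 < κ) (hD : 0 ≤ D)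
    (hstep : ∀ y, ‖y - p‖ < ρ → ∀ s, 0 ≤ s → s ≤ s₀ → ∀ q, ‖q - y‖ ≤ κ * s ^ N →
      ∃ y' T, T ≤ D * s ∧ Reaches 𝓕 K T y y' ∧ ‖q - y'‖ ≤ κ * (s / 2) ^ N) {τ : ℝ} (hτ : 0 < τ) :
    ∃ δ > 0, ∀ q, ‖q - p‖ ≤ δ → ∃ T ≤ τ, Reaches 𝓕 K T p q := by
  obtain ⟨s, hs, hss₀, hsτ, hsρ⟩ : ∃ s > 0, s ≤ s₀ ∧ D * (2 * s) ≤ τ ∧ K * (D * (2 * s)) < ρ := by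
    have h1 : Filter.Tendsto (fun s : ℝ => D * (2 * s)) (𝓝[>] 0) (𝓝 0) := by
      have : Continuous fun s : ℝ => D * (2 * s) := by fun_prop
      simpa using (this.tendsto 0).mono_left nhdsWithin_le_nhds
    have h2 : Filter.Tendsto (fun s : ℝ => K * (D * (2 * s))) (𝓝[>] 0) (𝓝 0) := by
      simpa using h1.const_mul (K : ℝ)
    have h3 : ∀ᶠ s : ℝ in 𝓝[>] 0, s ≤ s₀ :=
      Filter.Eventually.filter_mono nhdsWithin_le_nhds (Iic_mem_nhds hs₀)
    obtain ⟨s, hs⟩ := (eventually_mem_nhdsWithin.and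
      (h3.and ((h1.eventually (Iic_mem_nhds hτ)).and (h2.eventually (Iio_mem_nhds hρ))))).exists
    exact ⟨s, hs.1, hs.2.1, hs.2.2.1, hs.2.2.2⟩
  refine ⟨κ * s ^ N, by positivity, fun q hq => ?_⟩
  let sc : ℕ → ℝ := fun n => s / 2 ^ n
  have hsc0 : ∀ n, 0 < sc n := fun n => by positivity
  have hsc_succ : ∀ n, sc (n + 1) = sc n / 2 := fun n => by simp only [sc, pow_succ]; field_simp
  have hsc_le : ∀ n, sc n ≤ s := fun n => div_le_self hs.le (one_le_pow₀ one_le_two)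
  -- `2 * s - 2 * sc n` is the sum of the first `n` scales, so the second clause bounds the
  -- accumulated drift and keeps the points in the ball where `hstep` applies.
  let Inv : ℕ → E → Prop := fun n y =>
    ‖q - y‖ ≤ κ * sc n ^ N ∧ ‖y - p‖ ≤ K * (D * (2 * s - 2 * sc n))
  have hnext : ∀ n (y : {y // Inv n y}), ∃ y' : {y // Inv (n + 1) y},
      ∃ T, T ≤ D * sc n ∧ Reaches 𝓕 K T y y' := by
    rintro n ⟨y, hy1, hy2⟩
    have hyρ : ‖y - p‖ < ρ := by
      refine (hy2.trans ?_).trans_lt hsρ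
      gcongr
      linarith [hsc0 n]
    obtain ⟨y', T, hT, hR, hy'⟩ := hstep y hyρ (sc n) (hsc0 n).le ((hsc_le n).trans hss₀) q hy1
    refine ⟨⟨y', by rwa [hsc_succ], ?_⟩, T, hT, hR⟩
    have h1 := hR.norm_sub_le
    have h2 : (K : ℝ) * T ≤ K * (D * sc n) := by gcongr
    have h3 := norm_sub_le_norm_sub_add_norm_sub y' y p
    rw [hsc_succ]
    nlinarith
  choose next hnextT using hnext
  let Y : ∀ n, {y // Inv n y} := fun n =>
    Nat.rec ⟨p, by simpa [sc] using hq, by simp [sc]⟩ (fun n y => next n y) n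
  choose T hT hR using fun n => hnextT n (Y n)
  have hT0 : ∀ n, 0 ≤ T n := fun n => (hR n).nonneg
  have hgeom : HasSum (fun n => D * sc n) (D * (2 * s)) := by
    have h := (hasSum_geometric_two.mul_left s).mul_left D
    rw [mul_comm s 2] at h
    simpa [sc, div_eq_mul_inv] using h
  have hsum : Summable T := Summable.of_nonneg_of_le hT0 hT hgeom.summable
  have hlim : Filter.Tendsto (fun n => (Y n).1) Filter.atTop (𝓝 q) := by
    rw [tendsto_iff_norm_sub_tendsto_zero]
    have h0 : Filter.Tendsto (fun n => κ * sc n ^ N) Filter.atTop (𝓝 0) := by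
      have h1 : Filter.Tendsto sc Filter.atTop (𝓝 0) := by
        have := (tendsto_pow_atTop_nhds_zero_of_lt_one (r := (1 / 2 : ℝ)) (by norm_num)
          (by norm_num)).const_mul s
        simpa [sc, div_eq_mul_inv] using this
      simpa [zero_pow (by omega : N ≠ 0)] using (h1.pow N).const_mul κ
    refine squeeze_zero (fun _ => norm_nonneg _) (fun n => ?_) h0
    rw [norm_sub_rev]
    exact (Y n).2.1
  refine ⟨∑' n, T n, ?_, Reaches.of_hasSum hR hsum.hasSum hlim⟩
  exact (hsum.tsum_le_of_sum_le fun t => (Finset.sum_le_sum fun n _ => hT n).trans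
    (sum_le_hasSum t (fun n _ => mul_nonneg hD (hsc0 n).le) hgeom)).trans hsτ

/-- `𝓕` and `K` are fixed before `τ`, so that `τ` may later be chosen according to bounds on these
finitely many fields. -/
theorem exists_finite_reaches [FiniteDimensional ℝ E] {𝒢 : Set (smoothMaps E)} (hneg : ∀ V ∈ 𝒢, -V ∈ 𝒢)
    (hcs : ∀ V ∈ 𝒢, HasCompactSupport (V : E → E)) {p : E}
    (hspan : Submodule.span ℝ {v | ∃ Z, IsIteratedBracket 𝒢 Z ∧ Z p = v} = ⊤) :
    ∃ 𝓕 ⊆ 𝒢, 𝓕.Finite ∧ ∃ K : NNReal, ∀ τ > 0, ∃ δ > 0, ∀ q, ‖q - p‖ ≤ δ →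
      ∃ T ≤ τ, Reaches 𝓕 K T p q := by
  obtain ⟨β, hβ, hβspan, hβli⟩ := exists_linearIndependent ℝ
    {v : E | ∃ Z, IsIteratedBracket 𝒢 Z ∧ Z p = v}
  rw [hspan] at hβspan
  let b : Module.Basis β ℝ E := Module.Basis.mk hβli (by simp [hβspan])
  have hb : ∀ i, b i = (i : E) := fun i => by simp [b]
  have : Fintype β := FiniteDimensional.fintypeBasisIndex b
  choose Z hZ hZp using fun i : β => hβ i.2
  choose w hw r hr hZw using fun i => (hZ i).exists_word hneg
  let 𝓕 : Set (smoothMaps E) := ⋃ i, ({V | V ∈ w i} ∪ {V | V ∈ inverseWord (w i)})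
  have h𝓕 : 𝓕 ⊆ 𝒢 := by
    refine iUnion_subset fun i => union_subset (hw i) (mem_of_mem_inverseWord hneg (hw i))
  have hfin : 𝓕.Finite := finite_iUnion fun i => (List.finite_toSet _).union (List.finite_toSet _)
  choose! B hB using fun V (hV : V ∈ 𝒢) =>
    (contDiff_coe V).continuous.bounded_above_of_compact_support (hcs V hV)
  obtain ⟨K', hK'⟩ := (hfin.image B).bddAbove
  have hK : ∀ V ∈ 𝓕, ∀ x, ‖V x‖ ≤ (K'.toNNReal : ℝ) := fun V hV x =>
    (hB V (h𝓕 hV) x).trans ((hK' (mem_image_of_mem B hV)).trans (Real.le_coe_toNNReal K'))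
  refine ⟨𝓕, h𝓕, hfin, K'.toNNReal, fun τ hτ => ?_⟩
  set K := K'.toNNReal
  -- Exceeds every `r i`, and is positive even if the basis is empty.
  let N := ∑ i, r i + 1
  let D : ℝ := ∑ i, (w i).length
  have hD : 0 ≤ D := by positivity
  have hmove : ∀ i, ∀ η > 0, ∃ ρ > 0, ∃ s₀ > 0, ∀ y, ‖y - p‖ < ρ → ∀ s, 0 ≤ s → s ≤ s₀ →
      ∀ c : ℝ, |c| ≤ s ^ N → ∃ y' T, T ≤ D * s ∧ Reaches 𝓕 K T y y' ∧
        ‖y' - y - c • b i‖ ≤ η * |c| := by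
    intro i η hη
    have hrN : r i ≤ N :=
      (Finset.single_le_sum (fun j _ => Nat.zero_le (r j)) (Finset.mem_univ i)).trans
        (Nat.le_succ _)
    obtain ⟨ρ, hρ, s₀, hs₀, h⟩ := exists_signed_move (𝓕 := 𝓕) hK (fun V hV => hcs V (h𝓕 hV))
      (w := w i) (fun V hV => mem_iUnion.2 ⟨i, Or.inl hV⟩)
      (fun V hV => mem_iUnion.2 ⟨i, Or.inr hV⟩) (hr i) hrN (hZw i) p hη
    refine ⟨ρ, hρ, s₀, hs₀, fun y hy s hs hs' c hc => ?_⟩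
    obtain ⟨y', T, hT, hR, hy'⟩ := h y hy s hs hs' c hc
    refine ⟨y', T, hT.trans ?_, hR, by rwa [hb, ← hZp]⟩
    gcongr
    exact Finset.single_le_sum (f := fun j => ((w j).length : ℝ)) (fun j _ => by positivity)
      (Finset.mem_univ i)
  let M : ℝ := 1 + ∑ i, ‖(b.coord i).toContinuousLinearMap‖
  have hM : 0 < M := by positivity
  have hcoord : ∀ i v, |b.repr v i| ≤ ‖(b.coord i).toContinuousLinearMap‖ * ‖v‖ := fun i v =>
    (b.coord i).toContinuousLinearMap.le_opNorm v
  -- The coordinates of `q - y` have absolute sum at most `M * ‖q - y‖`, so this error ratio shrinks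
  -- the residual by the factor `2 ^ N` needed to pass from scale `s` to `s / 2`. The choice `κ = 1
  -- / M` below keeps each coordinate at most `s ^ N`.
  have hη : (0 : ℝ) < 1 / (2 ^ N * M) := by positivity
  obtain ⟨ρ, hρ, s₀, hs₀, h⟩ := exists_move_sum hD hmove hη
  refine exists_reaches_of_contraction (N := N) (by omega) (κ := 1 / M)
    (D := Fintype.card β * D) hρ hs₀ (by positivity) (by positivity) ?_ hτ
  intro y hy s hs hss q hq
  have hc : ∀ i, |b.repr (q - y) i| ≤ s ^ N := fun i => by
    refine (hcoord i _).trans ?_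
    calc _ ≤ M * (1 / M * s ^ N) := by
          gcongr
          refine (Finset.single_le_sum (f := fun j => ‖(b.coord j).toContinuousLinearMap‖)
            (fun j _ => norm_nonneg _) (Finset.mem_univ i)).trans ?_
          simp [M]
      _ = s ^ N := by field_simp
  obtain ⟨y', T, hT, hR, hy'⟩ := h y hy s hs hss _ hc
  refine ⟨y', T, hT, hR, ?_⟩
  rw [b.sum_repr] at hy'
  rw [norm_sub_rev, show y' - q = y' - y - (q - y) by abel]
  refine hy'.trans ?_
  have hsum : ∑ i, |b.repr (q - y) i| ≤ M * ‖q - y‖ := by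
    calc _ ≤ ∑ i, ‖(b.coord i).toContinuousLinearMap‖ * ‖q - y‖ :=
          Finset.sum_le_sum fun i _ => hcoord i _
      _ = (∑ i, ‖(b.coord i).toContinuousLinearMap‖) * ‖q - y‖ := (Finset.sum_mul _ _ _).symm
      _ ≤ M * ‖q - y‖ := by gcongr; simp [M]
  calc _ ≤ 1 / (2 ^ N * M) * (M * (1 / M * s ^ N)) := by
        gcongr
        exact hsum.trans (by gcongr)
    _ = 1 / M * (s / 2) ^ N := by rw [div_pow]; field_simp

end LocalControllability

/-! ### Cutting off local fields -/

section Cutoff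

variable {E : Type*} [NormedAddCommGroup E] [NormedSpace ℝ E] [FiniteDimensional ℝ E]

theorem exists_smoothMap_eventuallyEq {f : E → E} {p : E} (hf : ∀ᶠ y in 𝓝 p, ContDiffAt ℝ ∞ f y) :
    ∃ F : smoothMaps E, HasCompactSupport (F : E → E) ∧ (F : E → E) =ᶠ[𝓝 p] f := by
  obtain ⟨r, hr, hfr⟩ := Metric.eventually_nhds_iff_ball.1 hf
  let χ : ContDiffBump p := ⟨r / 4, r / 2, by positivity, by linarith⟩
  have hsmooth : ContDiff ℝ ∞ (fun y => χ y • f y) := by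
    rw [contDiff_iff_contDiffAt]
    intro y
    by_cases hy : y ∈ Metric.ball p r
    · exact χ.contDiffAt.smul (hfr y hy)
    · have h0 : y ∉ tsupport χ := by
        rw [χ.tsupport_eq]
        intro h
        exact hy (Metric.closedBall_subset_ball (by change r / 2 < r; linarith) h)
      refine (contDiffAt_const (c := (0 : E))).congr_of_eventuallyEq ?_
      filter_upwards [(notMem_tsupport_iff_eventuallyEq.1 h0)] with z hz
      rw [hz]; simp
  refine ⟨⟨fun y => χ y • f y, hsmooth⟩, χ.hasCompactSupport.smul_right, ?_⟩
  filter_upwards [χ.eventuallyEq_one] with y hy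
  simp only [hy, Pi.one_apply, one_smul]

end Cutoff

/-! ### Horizontal fields and brackets in a chart -/

section Chart

theorem eventually_mem_extChartAt_target {E : Type*} [NormedAddCommGroup E] [NormedSpace ℝ E] {M : Type*}
    [TopologicalSpace M] [ChartedSpace E M] (x₀ : M) {U : Set M} (hU : IsOpen U) (hx₀ : x₀ ∈ U) :
    ∀ᶠ y in 𝓝 (extChartAt 𝓘(ℝ, E) x₀ x₀), y ∈ (extChartAt 𝓘(ℝ, E) x₀).target ∧
      (extChartAt 𝓘(ℝ, E) x₀).symm y ∈ U := by
  have h : (extChartAt 𝓘(ℝ, E) x₀).symm (extChartAt 𝓘(ℝ, E) x₀ x₀) = x₀ := extChartAt_to_inv x₀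
  refine Filter.Eventually.and (extChartAt_target_mem_nhds x₀)
    ((continuousAt_extChartAt_symm x₀).eventually (hU.eventually_mem ?_))
  rwa [h]

variable {E : Type*} [NormedAddCommGroup E] [NormedSpace ℝ E]
  {M : Type*} [TopologicalSpace M] [ChartedSpace E M] [IsManifold 𝓘(ℝ, E) ∞ M]

/-- The coordinate representation, in the preferred chart at `x₀`, of a vector field on `M`. -/
noncomputable def chartField (x₀ : M) (X : ∀ x : M, TangentSpace 𝓘(ℝ, E) x) : E → E :=
  VectorField.mpullback 𝓘(ℝ, E) 𝓘(ℝ, E) (extChartAt 𝓘(ℝ, E) x₀).symm X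

theorem contMDiffAt_extChartAt_symm' {x₀ : M} {y : E} (hy : y ∈ (extChartAt 𝓘(ℝ, E) x₀).target) :
    ContMDiffAt 𝓘(ℝ, E) 𝓘(ℝ, E) ∞ (extChartAt 𝓘(ℝ, E) x₀).symm y :=
  (contMDiffOn_extChartAt_symm x₀).contMDiffAt ((isOpen_extChartAt_target x₀).mem_nhds hy)

theorem isInvertible_mfderiv_extChartAt_symm {x₀ : M} {y : E}
    (hy : y ∈ (extChartAt 𝓘(ℝ, E) x₀).target) :
    (mfderiv 𝓘(ℝ, E) 𝓘(ℝ, E) (extChartAt 𝓘(ℝ, E) x₀).symm y).IsInvertible := by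
  have := isInvertible_mfderivWithin_extChartAt_symm (I := 𝓘(ℝ, E)) hy
  rwa [ModelWithCorners.range_eq_univ, mfderivWithin_univ] at this

theorem LocalVectorField.contMDiffAt (X : LocalVectorField E M) {x : M} (hx : x ∈ X.dom) :
    ContMDiffAt 𝓘(ℝ, E) 𝓘(ℝ, E).tangent ∞
      (fun x => (⟨x, X.toFun x⟩ : TangentBundle 𝓘(ℝ, E) M)) x :=
  (X.smooth x hx).contMDiffAt (X.isOpen_dom.mem_nhds hx)

theorem contDiffAt_chartField [FiniteDimensional ℝ E] {x₀ : M} (X : LocalVectorField E M) {y : E}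
    (hy : y ∈ (extChartAt 𝓘(ℝ, E) x₀).target) (hX : (extChartAt 𝓘(ℝ, E) x₀).symm y ∈ X.dom) :
    ContDiffAt ℝ ∞ (chartField x₀ X.toFun) y := by
  have := FiniteDimensional.complete ℝ E
  refine contMDiffAt_vectorSpace_iff_contDiffAt.1 ?_
  exact ContMDiffAt.mpullback_vectorField_preimage (n := ∞) (X.contMDiffAt hX)
    (contMDiffAt_extChartAt_symm' hy) (isInvertible_mfderiv_extChartAt_symm hy) (by simp)

theorem chartField_bracket [FiniteDimensional ℝ E] {x₀ : M} (X Y : LocalVectorField E M) {y : E}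
    (hy : y ∈ (extChartAt 𝓘(ℝ, E) x₀).target) (hX : (extChartAt 𝓘(ℝ, E) x₀).symm y ∈ X.dom)
    (hY : (extChartAt 𝓘(ℝ, E) x₀).symm y ∈ Y.dom) :
    chartField x₀ (X.bracket Y).toFun y =
      VectorField.lieBracket ℝ (chartField x₀ X.toFun) (chartField x₀ Y.toFun) y := by
  have := FiniteDimensional.complete ℝ E
  have h2 : (2 : ℕ∞ω) ≤ (∞ : ℕ∞ω) := by simpa using WithTop.coe_le_coe.2 (le_top : (2 : ℕ∞) ≤ ⊤)
  have h3 : (3 : ℕ∞ω) ≤ (∞ : ℕ∞ω) := by simpa using WithTop.coe_le_coe.2 (le_top : (3 : ℕ∞) ≤ ⊤)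
  have hm : IsManifold 𝓘(ℝ, E) (minSmoothness ℝ 3) M := by
    rw [minSmoothness_of_isRCLikeNormedField]
    exact IsManifold.of_le h3
  have hm' : IsManifold 𝓘(ℝ, E) (minSmoothness ℝ 3) E := inferInstance
  have h := VectorField.mpullback_mlieBracket (I := 𝓘(ℝ, E)) (I' := 𝓘(ℝ, E)) (n := ∞)
    ((X.contMDiffAt hX).mdifferentiableAt (by simp))
    ((Y.contMDiffAt hY).mdifferentiableAt (by simp)) (contMDiffAt_extChartAt_symm' hy)
    (by rw [minSmoothness_of_isRCLikeNormedField]; exact h2)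
  have h' := congrFun (VectorField.mlieBracketWithin_eq_lieBracketWithin (𝕜 := ℝ) (E := E)
    (V := chartField x₀ X.toFun) (W := chartField x₀ Y.toFun) (s := univ)) y
  have e₁ := congrFun (VectorField.mlieBracketWithin_univ (I := 𝓘(ℝ, E)) (M := E)
    (V := chartField x₀ X.toFun) (W := chartField x₀ Y.toFun)) y
  have e₂ := congrFun (VectorField.lieBracketWithin_univ (𝕜 := ℝ)
    (V := chartField x₀ X.toFun) (W := chartField x₀ Y.toFun)) y
  exact h.trans (e₁.symm.trans (h'.trans e₂))

/-- The compactly supported vector fields on `E` that represent, near the point corresponding to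
`x₀`, a horizontal vector field defined near `x₀`. -/
def horizontalChartFields (H : TangentDistribution E M) (x₀ : M) : Set (smoothMaps E) :=
  {F | HasCompactSupport (F : E → E) ∧ ∃ X ∈ H.horizontalFields, x₀ ∈ X.dom ∧
    (F : E → E) =ᶠ[𝓝 (extChartAt 𝓘(ℝ, E) x₀ x₀)] chartField x₀ X.toFun}

/-- The opposite of a local vector field. -/
noncomputable def LocalVectorField.opposite (X : LocalVectorField E M) : LocalVectorField E M where
  dom := X.dom
  isOpen_dom := X.isOpen_dom
  toFun := -X.toFun
  smooth := ContMDiffOn.neg_section X.smooth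

theorem neg_mem_horizontalChartFields {H : TangentDistribution E M} {x₀ : M} {F : smoothMaps E}
    (hF : F ∈ horizontalChartFields H x₀) : -F ∈ horizontalChartFields H x₀ := by
  obtain ⟨hcs, X, hX, hx₀, hFX⟩ := hF
  refine ⟨?_, X.opposite, fun x hx => (H x).neg_mem (hX x hx), hx₀, ?_⟩
  · exact hcs.neg
  · filter_upwards [hFX] with y hy
    change -(F y) = _
    rw [hy]
    exact (VectorField.mpullback_neg_apply).symm

/-- The fields with this property form an involutive set containing the horizontal fields, hence
contain the Lie hull. Agreement near the point, not only at it, is needed to pass to brackets. -/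
theorem exists_isIteratedBracket_eventuallyEq [FiniteDimensional ℝ E] {H : TangentDistribution E M} (x₀ : M)
    {Z : LocalVectorField E M} (hZ : Z ∈ lieHull H.horizontalFields) (hx₀ : x₀ ∈ Z.dom) :
    ∃ F, IsIteratedBracket (horizontalChartFields H x₀) F ∧
      (F : E → E) =ᶠ[𝓝 (extChartAt 𝓘(ℝ, E) x₀ x₀)] chartField x₀ Z.toFun := by
  let 𝒲 : Set (LocalVectorField E M) := {Z | x₀ ∈ Z.dom →
    ∃ F, IsIteratedBracket (horizontalChartFields H x₀) F ∧
      (F : E → E) =ᶠ[𝓝 (extChartAt 𝓘(ℝ, E) x₀ x₀)] chartField x₀ Z.toFun}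
  refine mem_sInter.1 hZ 𝒲 ⟨?_, ?_⟩ hx₀
  · intro X hX hx
    obtain ⟨F, hcs, hF⟩ := exists_smoothMap_eventuallyEq
      ((eventually_mem_extChartAt_target x₀ X.isOpen_dom hx).mono fun y hy =>
        contDiffAt_chartField X hy.1 hy.2)
    exact ⟨F, .of ⟨hcs, X, hX, hx, hF⟩, hF⟩
  · rintro X hX Y hY ⟨hx, hy⟩
    obtain ⟨F, hF, hFX⟩ := hX hx
    obtain ⟨G, hG, hGY⟩ := hY hy
    refine ⟨fieldBracket F G, .bracket hF hG, ?_⟩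
    rw [coe_fieldBracket]
    refine (hFX.lieBracket_vectorField hGY).trans ?_
    filter_upwards [eventually_mem_extChartAt_target x₀ X.isOpen_dom hx,
      eventually_mem_extChartAt_target x₀ Y.isOpen_dom hy] with y h1 h2
    exact (chartField_bracket X Y h1.1 h1.2 h2.2).symm

/-- The differential of the inverse chart is an isomorphism, so it carries the spanning property at
`x₀` over to the chart. -/
theorem span_isIteratedBracket_eq_top [FiniteDimensional ℝ E] {H : TangentDistribution E M} (hgen : H.IsBracketGenerating)
    (x₀ : M) : Submodule.span ℝ {v | ∃ F, IsIteratedBracket (horizontalChartFields H x₀) F ∧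
      F (extChartAt 𝓘(ℝ, E) x₀ x₀) = v} = ⊤ := by
  set p := extChartAt 𝓘(ℝ, E) x₀ x₀ with hp
  obtain ⟨A, hA⟩ := isInvertible_mfderiv_extChartAt_symm (mem_extChartAt_target (I := 𝓘(ℝ, E)) x₀)
  have hx₀ : (extChartAt 𝓘(ℝ, E) x₀).symm p = x₀ := extChartAt_to_inv x₀
  let B : E ≃L[ℝ] E := A
  have hB : ∀ Z : LocalVectorField E M, chartField x₀ Z.toFun p = B.symm (Z.toFun x₀) := by
    intro Z
    have h1 : chartField x₀ Z.toFun p = B.symm (Z.toFun ((extChartAt 𝓘(ℝ, E) x₀).symm p)) := by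
      change (mfderiv 𝓘(ℝ, E) 𝓘(ℝ, E) (extChartAt 𝓘(ℝ, E) x₀).symm p).inverse _ = _
      rw [← hA, ContinuousLinearMap.inverse_equiv]
      rfl
    rw [h1]
    exact congrArg (fun x => B.symm (Z.toFun x : E)) hx₀
  have hspan : Submodule.span ℝ {v : E | ∃ Z ∈ lieHull H.horizontalFields,
      x₀ ∈ Z.dom ∧ Z.toFun x₀ = v} = ⊤ := hgen x₀
  have hmap := congrArg (Submodule.map (B.symm.toLinearEquiv : E →ₗ[ℝ] E)) hspan
  rw [Submodule.map_span, Submodule.map_top, LinearEquiv.range] at hmap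
  rw [eq_top_iff, ← hmap]
  refine Submodule.span_mono ?_
  rintro _ ⟨v, ⟨Z, hZ, hx, rfl⟩, rfl⟩
  obtain ⟨F, hF, hFZ⟩ := exists_isIteratedBracket_eventuallyEq x₀ hZ hx
  exact ⟨F, hF, hFZ.eq_of_nhds.trans (hB Z)⟩

end Chart

/-! ### Measurable switching controls -/

section Controls

variable {E : Type*} [NormedAddCommGroup E] [NormedSpace ℝ E]

/-- The set of times at which the velocity of `c` is the value of `F`. -/
def velocitySet (c : ℝ → E) (F : E → E) : Set ℝ := {t | HasDerivAt c (F (c t)) t}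

theorem measurableSet_velocitySet [FiniteDimensional ℝ E] {c : ℝ → E} (hc : Continuous c)
    {F : E → E} (hF : Continuous F) : MeasurableSet (velocitySet c F) := by
  have := FiniteDimensional.complete ℝ E
  borelize E
  have e : velocitySet c F = {t | DifferentiableAt ℝ c t} ∩ {t | deriv c t = F (c t)} := by
    ext t
    constructor
    · intro h
      exact ⟨h.differentiableAt, h.deriv⟩
    · rintro ⟨h1, h2⟩
      change HasDerivAt c (F (c t)) t
      rw [← h2]
      exact h1.hasDerivAt
  rw [e]
  have : SecondCountableTopology E := secondCountable_of_proper
  exact (measurableSet_of_differentiableAt ℝ c).inter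
    (measurableSet_eq_fun (measurable_deriv c) (hF.comp hc).measurable)

/-- The control that switches on `F i` when it is the first field whose value is the velocity. -/
noncomputable def switchControl {k : ℕ} (c : ℝ → E) (F : Fin k → E → E) (i : Fin k) : ℝ → ℝ :=
  (velocitySet c (F i) \ ⋃ j : {j // j < i}, velocitySet c (F j)).indicator 1

theorem integrableOn_switchControl [FiniteDimensional ℝ E] {k : ℕ} {c : ℝ → E} (hc : Continuous c)
    {F : Fin k → E → E} (hF : ∀ i, Continuous (F i)) (i : Fin k) (a b : ℝ) :
    IntegrableOn (switchControl c F i) (Icc a b) := by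
  have hm : MeasurableSet (velocitySet c (F i) \ ⋃ j : {j // j < i}, velocitySet c (F j)) :=
    (measurableSet_velocitySet hc (hF i)).diff
      (MeasurableSet.iUnion fun j => measurableSet_velocitySet hc (hF j))
  have h1 : IntegrableOn (1 : ℝ → ℝ) (Icc a b) := integrableOn_const (by simp)
  exact h1.indicator hm

/-- Taking the first admissible index makes exactly one control equal to `1`, even where several
fields give the velocity. The vectors `v` are arbitrary, so the fields on `M` may replace their
chart representatives. -/
theorem exists_sum_switchControl_smul {k : ℕ} {c : ℝ → E} {F : Fin k → E → E} {t : ℝ}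
    (h : ∃ i, t ∈ velocitySet c (F i)) :
    ∃ i, t ∈ velocitySet c (F i) ∧ ∀ {W : Type*} [AddCommGroup W] [Module ℝ W] (v : Fin k → W),
      ∑ j, switchControl c F j t • v j = v i := by
  classical
  obtain ⟨i, hi, hmin⟩ := WellFounded.has_min (wellFounded_lt (α := Fin k))
    {i | t ∈ velocitySet c (F i)} h
  refine ⟨i, hi, fun v => ?_⟩
  rw [Finset.sum_eq_single i]
  · rw [switchControl, indicator_of_mem]
    · simp
    · refine ⟨hi, ?_⟩
      simp only [mem_iUnion, not_exists]
      exact fun j hj => hmin j hj j.2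
  · intro j _ hji
    rw [switchControl, indicator_of_notMem, zero_smul]
    rintro ⟨h1, h2⟩
    rcases lt_or_gt_of_ne hji with h | h
    · exact hmin j h1 h
    · exact h2 (mem_iUnion.2 ⟨⟨i, h⟩, hi⟩)
  · simp

end Controls

/-! ### Transfer of trajectories to horizontal curves on the manifold -/

section Curves

variable {E : Type*} [NormedAddCommGroup E] [NormedSpace ℝ E]
  {M : Type*} [TopologicalSpace M] [ChartedSpace E M] [IsManifold 𝓘(ℝ, E) ∞ M]

/-- Changes of chart are `C¹`, hence locally Lipschitz; on a compact interval the composite is then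
Lipschitz, so absolutely continuous. -/
theorem isAbsolutelyContinuousCurve_of_lipschitz {x₀ : M} {K : NNReal} {c : ℝ → E}
    (hc : LipschitzWith K c) {a b : ℝ}
    (hmem : ∀ t ∈ Icc a b, c t ∈ (extChartAt 𝓘(ℝ, E) x₀).target) :
    IsAbsolutelyContinuousCurve E (fun t => (extChartAt 𝓘(ℝ, E) x₀).symm (c t)) a b := by
  refine ⟨(continuousOn_extChartAt_symm x₀).comp hc.continuous.continuousOn hmem, ?_⟩
  intro e he t₀ t₁ ha h01 hb hsrc
  have hloc : LocallyLipschitzOn (Icc t₀ t₁)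
      (fun t => e ((extChartAt 𝓘(ℝ, E) x₀).symm (c t))) := by
    intro t ht
    have hct := hmem t ⟨ha.trans ht.1, ht.2.trans hb⟩
    have h1 : ContMDiffAt 𝓘(ℝ, E) 𝓘(ℝ, E) ∞ (e ∘ (extChartAt 𝓘(ℝ, E) x₀).symm) (c t) :=
      (contMDiffAt_of_mem_maximalAtlas he (hsrc t ht)).comp (c t) (contMDiffAt_extChartAt_symm' hct)
    obtain ⟨L, u, hu, hL⟩ := ((contMDiffAt_iff_contDiffAt.1 h1).of_le
      (by simp : (1 : ℕ∞ω) ≤ (∞ : ℕ∞ω))).exists_lipschitzOnWith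
    refine ⟨L * K, c ⁻¹' u, mem_nhdsWithin_of_mem_nhds (hc.continuous.continuousAt hu), ?_⟩
    exact hL.comp hc.lipschitzOnWith (mapsTo_preimage _ _)
  obtain ⟨L, hL⟩ := hloc.exists_lipschitzOnWith_of_compact isCompact_Icc
  refine LipschitzOnWith.absolutelyContinuousOnInterval (K := L) ?_
  rwa [uIcc_of_le h01]

theorem hasMFDerivAt_extChartAt_symm_comp {x₀ : M} {c : ℝ → E} {t : ℝ}
    {X : ∀ x : M, TangentSpace 𝓘(ℝ, E) x} (hct : c t ∈ (extChartAt 𝓘(ℝ, E) x₀).target)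
    (hc : HasDerivAt c (chartField x₀ X (c t)) t) :
    HasMFDerivAt 𝓘(ℝ, ℝ) 𝓘(ℝ, E) (fun t => (extChartAt 𝓘(ℝ, E) x₀).symm (c t)) t
      ((1 : ℝ →L[ℝ] ℝ).smulRight (X ((extChartAt 𝓘(ℝ, E) x₀).symm (c t)))) := by
  have h1 := ((contMDiffAt_extChartAt_symm' hct).mdifferentiableAt (by simp)).hasMFDerivAt
  have h2 := HasMFDerivAt.comp t h1 hc.hasFDerivAt.hasMFDerivAt
  obtain ⟨A, hA⟩ := isInvertible_mfderiv_extChartAt_symm hct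
  have hfield : mfderiv 𝓘(ℝ, E) 𝓘(ℝ, E) (extChartAt 𝓘(ℝ, E) x₀).symm (c t)
      (chartField (E := E) x₀ X (c t)) = X ((extChartAt 𝓘(ℝ, E) x₀).symm (c t)) := by
    have e : chartField x₀ X (c t) =
      (mfderiv 𝓘(ℝ, E) 𝓘(ℝ, E) (extChartAt 𝓘(ℝ, E) x₀).symm (c t)).inverse
        (X ((extChartAt 𝓘(ℝ, E) x₀).symm (c t))) := rfl
    rw [e, ← hA, ContinuousLinearMap.inverse_equiv]
    exact A.apply_symm_apply _
  refine h2.congr_mfderiv (ContinuousLinearMap.ext_ring ?_)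
  rw [← hfield]
  symm
  change (1 : ℝ) • _ = mfderiv 𝓘(ℝ, E) 𝓘(ℝ, E) (extChartAt 𝓘(ℝ, E) x₀).symm (c t)
    ((1 : ℝ) • chartField (E := E) x₀ X (c t))
  rw [one_smul, one_smul]

theorem SubriemannianMetric.exists_eventually_norm_le {H : TangentDistribution E M}
    (g : SubriemannianMetric H) {X : LocalVectorField E M} (hX : X ∈ H.horizontalFields) {x₀ : M}
    (hx₀ : x₀ ∈ X.dom) : ∃ C, ∀ᶠ x in 𝓝 x₀, g.norm x (X.toFun x) ≤ C := by
  have h1 := ((g.smooth X hX X hX).continuousOn).continuousAt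
    ((X.isOpen_dom.inter X.isOpen_dom).mem_nhds ⟨hx₀, hx₀⟩)
  refine ⟨_, ((Real.continuous_sqrt.continuousAt.comp h1).eventually_le_const
    (lt_add_one _)).mono fun x hx => hx⟩

/-- The curve in `M` that corresponds to a trajectory of horizontal fields in a chart is horizontal,
with controlled length. -/
theorem isHorizontalCurve_of_isTrajectory [FiniteDimensional ℝ E] {H : TangentDistribution E M}
    (g : SubriemannianMetric H) {x₀ : M} {𝓕 : Set (smoothMaps E)} {k : ℕ} {F : Fin k → smoothMaps E}
    (h𝓕 : ∀ V ∈ 𝓕, ∃ i, F i = V) {X : Fin k → LocalVectorField E M}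
    (hX : ∀ i, X i ∈ H.horizontalFields) {U : Set E}
    (hUt : ∀ y ∈ U, y ∈ (extChartAt 𝓘(ℝ, E) x₀).target)
    (hUd : ∀ y ∈ U, ∀ i, (extChartAt 𝓘(ℝ, E) x₀).symm y ∈ (X i).dom)
    (hUF : ∀ y ∈ U, ∀ i, F i y = chartField x₀ (X i).toFun y) {C : ℝ}
    (hUC : ∀ y ∈ U, ∀ i, g.norm ((extChartAt 𝓘(ℝ, E) x₀).symm y)
      ((X i).toFun ((extChartAt 𝓘(ℝ, E) x₀).symm y)) ≤ C)
    {K : NNReal} {T : ℝ} {c : ℝ → E} {y y' : E} (hc : IsTrajectory 𝓕 K c T y y')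
    (hcU : ∀ t ∈ Icc 0 T, c t ∈ U) :
    IsHorizontalCurve H (fun t => (extChartAt 𝓘(ℝ, E) x₀).symm (c t)) 0 T ∧
      g.length (fun t => (extChartAt 𝓘(ℝ, E) x₀).symm (c t)) 0 T ≤ ENNReal.ofReal (C * T) := by
  set γ : ℝ → M := fun t => (extChartAt 𝓘(ℝ, E) x₀).symm (c t) with hγ
  obtain ⟨S, hS, hd⟩ := hc.deriv
  have hae : ∀ᵐ t ∂(volume.restrict (Icc 0 T)), t ∈ Icc 0 T ∧
      ∃ i, t ∈ velocitySet c (F i) := by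
    have hS' : (S ∪ {0, T}).Countable := hS.union ((countable_singleton T).insert 0)
    filter_upwards [ae_restrict_mem measurableSet_Icc,
      ae_restrict_of_ae (compl_mem_ae_iff.2 (hS'.measure_zero volume))] with t ht htS
    simp only [mem_union, mem_insert_iff, mem_singleton_iff, not_or] at htS
    obtain ⟨V, hV, hVd⟩ := hd t ⟨lt_of_le_of_ne ht.1 (Ne.symm htS.2.1),
      lt_of_le_of_ne ht.2 htS.2.2⟩ htS.1
    obtain ⟨i, rfl⟩ := h𝓕 V hV
    exact ⟨ht, i, hVd⟩
  have hder : ∀ t ∈ Icc 0 T, ∀ i, t ∈ velocitySet c (F i) →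
      HasMFDerivAt 𝓘(ℝ, ℝ) 𝓘(ℝ, E) γ t ((1 : ℝ →L[ℝ] ℝ).smulRight ((X i).toFun (γ t))) := by
    intro t ht i hi
    refine hasMFDerivAt_extChartAt_symm_comp (hUt _ (hcU t ht)) ?_
    rw [← hUF _ (hcU t ht) i]
    exact hi
  constructor
  · refine .controlled hc.nonneg X hX ⟨fun i t ht => hUd _ (hcU t ht) i,
      isAbsolutelyContinuousCurve_of_lipschitz hc.lipschitz fun t ht => hUt _ (hcU t ht),
      switchControl c (fun i => F i), fun i => integrableOn_switchControl hc.lipschitz.continuous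
        (fun i => (contDiff_coe (F i)).continuous) i 0 T, ?_⟩
    filter_upwards [hae] with t ht
    obtain ⟨i, hi, hsum⟩ := exists_sum_switchControl_smul ht.2
    have := hsum fun j => (X j).toFun (γ t)
    rw [this]
    exact hder t ht.1 i hi
  · calc g.length γ 0 T ≤ ∫⁻ _ in Icc 0 T, ENNReal.ofReal C := by
          refine lintegral_mono_ae ?_
          filter_upwards [hae] with t ⟨ht, i, hi⟩
          refine ENNReal.ofReal_le_ofReal ?_
          rw [(hder t ht i hi).mfderiv]
          have e : ((1 : ℝ →L[ℝ] ℝ).smulRight ((X i).toFun (γ t))) (1 : ℝ) = (X i).toFun (γ t) := by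
            change (1 : ℝ) • (X i).toFun (γ t) = _
            rw [one_smul]
          exact (congrArg (g.norm (γ t)) e).trans_le (hUC _ (hcU t ht) i)
      _ = ENNReal.ofReal (C * T) := by
          rw [setLIntegral_const, Real.volume_Icc, sub_zero, ENNReal.ofReal_mul' hc.nonneg]

end Curves

end Subriemannian

/-! ### Chow's theorem for subriemannian balls -/

theorem mainTheorem4
    {E : Type*} [NormedAddCommGroup E] [NormedSpace ℝ E] [FiniteDimensional ℝ E]
    {M : Type*} [TopologicalSpace M] [T2Space M] [ParacompactSpace M]
    [ChartedSpace E M] [IsManifold 𝓘(ℝ, E) ∞ M]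
    (H : Subriemannian.TangentDistribution E M)
    (hsmooth : H.IsSmooth) (hreg : H.IsRegular) (hgen : H.IsBracketGenerating)
    (g : Subriemannian.SubriemannianMetric H)
    (x₀ : M) (ε : ℝ) (hε : 0 < ε) :
    g.ball ε x₀ ∈ 𝓝 x₀ := by
  open Subriemannian in
  set p := extChartAt 𝓘(ℝ, E) x₀ x₀ with hp
  obtain ⟨𝓕, h𝓕, hfin, K, hreach⟩ := exists_finite_reaches
    (𝒢 := horizontalChartFields H x₀) (fun V hV => neg_mem_horizontalChartFields hV)
    (fun V hV => hV.1) (span_isIteratedBracket_eq_top hgen x₀)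
  have := hfin.to_subtype
  obtain ⟨k, ⟨e⟩⟩ := Finite.exists_equiv_fin 𝓕
  let F : Fin k → smoothMaps E := fun i => (e.symm i : smoothMaps E)
  have hF𝓕 : ∀ V ∈ 𝓕, ∃ i, F i = V := fun V hV => ⟨e ⟨V, hV⟩, by simp [F]⟩
  choose X hX hx₀ hFX using fun i => (h𝓕 (e.symm i).2).2
  choose C hC using fun i => g.exists_eventually_norm_le (hX i) (hx₀ i)
  let B : ℝ := 1 + ∑ i, |C i|
  have hB : 0 < B := by positivity
  have hCB : ∀ i, C i ≤ B := fun i => by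
    have := Finset.single_le_sum (f := fun i => |C i|) (fun j _ => abs_nonneg _) (Finset.mem_univ i)
    have := le_abs_self (C i)
    simp only [B]
    linarith
  have hev : ∀ᶠ y in 𝓝 p, y ∈ (extChartAt 𝓘(ℝ, E) x₀).target ∧ ∀ i,
      (extChartAt 𝓘(ℝ, E) x₀).symm y ∈ (X i).dom ∧ F i y = chartField x₀ (X i).toFun y ∧
      g.norm ((extChartAt 𝓘(ℝ, E) x₀).symm y)
        ((X i).toFun ((extChartAt 𝓘(ℝ, E) x₀).symm y)) ≤ B := by
    refine Filter.Eventually.and (extChartAt_target_mem_nhds x₀) (Filter.eventually_all.2 fun i => ?_)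
    have hcont := continuousAt_extChartAt_symm (I := 𝓘(ℝ, E)) x₀
    have hC' := hC i
    rw [← extChartAt_to_inv (I := 𝓘(ℝ, E)) x₀] at hC'
    filter_upwards [eventually_mem_extChartAt_target x₀ (X i).isOpen_dom (hx₀ i), hFX i,
      hcont.eventually hC'] with y h1 h2 h3
    exact ⟨h1.2, h2, h3.trans (hCB i)⟩
  obtain ⟨R, hR, hball⟩ := Metric.eventually_nhds_iff_ball.1 hev
  -- `K * τ < R` confines the trajectories to the ball where the chart description and the norm
  -- bound hold; `B * τ < ε` bounds their lengths.
  obtain ⟨τ, hτ, hKτ, hBτ⟩ : ∃ τ > 0, K * τ < R ∧ B * τ < ε := by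
    refine ⟨min (R / (2 * (K + 1))) (ε / (2 * B)), by positivity, ?_, ?_⟩
    · calc (K : ℝ) * _ ≤ (K + 1) * (R / (2 * (K + 1))) := by
            gcongr
            · linarith
            · exact min_le_left _ _
        _ = R / 2 := by field_simp
        _ < R := by linarith
    · calc B * _ ≤ B * (ε / (2 * B)) := by gcongr; exact min_le_right _ _
        _ = ε / 2 := by field_simp
        _ < ε := by linarith
  obtain ⟨δ, hδ, hq⟩ := hreach τ hτ
  have hnear : ∀ᶠ x in 𝓝 x₀, x ∈ (extChartAt 𝓘(ℝ, E) x₀).source ∧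
      extChartAt 𝓘(ℝ, E) x₀ x ∈ Metric.closedBall p δ :=
    Filter.Eventually.and (extChartAt_source_mem_nhds x₀)
      ((continuousAt_extChartAt x₀).eventually (Metric.closedBall_mem_nhds p hδ))
  filter_upwards [hnear] with x hx
  obtain ⟨T, hTτ, c, hc⟩ := hq (extChartAt 𝓘(ℝ, E) x₀ x) (by rw [← dist_eq_norm]; exact hx.2)
  have hcU : ∀ t ∈ Icc 0 T, c t ∈ Metric.ball p R := by
    intro t ht
    have h1 := hc.lipschitz.dist_le_mul t 0
    rw [hc.left 0 le_rfl, dist_zero_right, Real.norm_of_nonneg ht.1] at h1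
    refine Metric.mem_ball.2 (h1.trans_lt (lt_of_le_of_lt ?_ hKτ))
    gcongr
    exact ht.2.trans hTτ
  obtain ⟨hhor, hlen⟩ := isHorizontalCurve_of_isTrajectory g hF𝓕 hX
    (fun y hy => (hball y hy).1) (fun y hy i => ((hball y hy).2 i).1)
    (fun y hy i => ((hball y hy).2 i).2.1) (fun y hy i => ((hball y hy).2 i).2.2) hc hcU
  have h0 : (extChartAt 𝓘(ℝ, E) x₀).symm (c 0) = x₀ := by
    rw [hc.left 0 le_rfl]; exact extChartAt_to_inv x₀
  have h1 : (extChartAt 𝓘(ℝ, E) x₀).symm (c T) = x := by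
    rw [hc.right T le_rfl]; exact (extChartAt 𝓘(ℝ, E) x₀).left_inv hx.1
  have hdist : g.dist x₀ x ≤ _ := sInf_le ⟨_, 0, T, hhor, h0, h1, rfl⟩
  refine (hdist.trans hlen).trans_lt ((ENNReal.ofReal_lt_ofReal_iff hε).2 (lt_of_le_of_lt ?_ hBτ))
  gcongr
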